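/- Let $D^2$ be the closed unit disc in $\mathbb R^2$ with polar coordinates $(r,\theta)$ and area form $\omega=r\,dr\wedge d\theta$. All homeomorphisms and Hamiltonians below are supported in a compact subset of $\operatorname{Int}D^2$. *Definitions.* For a compact $K\subset\operatorname{Int}D^2$, let $\mathcal Q_K$ be the set of pairs $(\phi_H,H)$, where $H$ is a smooth time-dependent Hamiltonian on $[0,1]\times D^2$ supported in $[0,1]\times K$ and $\phi_H=(\phi_H^t)_{t\in[0,1]}$ is the flow of $X_{H}$, $dH_t=\omega(X_{H_t},\cdot)$. Let $\overline{\mathcal Q}_K$ be its closure among pairs (path of homeomorphisms, function) in the topology of uniform convergence of the paths, of their inverses, and of the Hamiltonians. Then $Hameo(D^2,\partial D^2)$ is the set of time-one maps $\lambda(1)$ of pairs $(\lambda,H)\in\overline{\mathcal Q}_K$, over all $K$; its Hamiltonian topology is the strongest one for which all the evaluation maps $\overline{\mathcal Q}_K\to Hameo(D^2,\partial D^2)$, $(\lambda,H)\mapsto\lambda(1)$, are continuous. $Sympeo(D^2,\partial D^2)$ is the set of homeomorphisms $\phi$ for which there is a compact $K\subset\operatorname{Int}D^2$ such that $\phi$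 is a uniform limit (together with its inverse) of $\omega$-preserving diffeomorphisms supported in $K$. The Calabi homomorphism on the group of time-one maps of smooth Hamiltonians is $\operatorname{Cal}(\phi_H^1)=\int_0^1\int_{D^2}H_t\,\omega\,dt$. *The infinite twist.* Let $\rho_k:(0,1]\to[0,\infty)$, $k\ge1$, be smooth functions such that $\rho_k$ has support in the open interval $(2^{-k},2^{-(k-1)})$; $\rho_k(r)=2^4\rho_{k-1}(2r)$ for $k\ge2$ and $r\in(2^{-k},2^{-(k-1)})$; and $\operatorname{Cal}(\phi_{\rho_1})=-\int_{D^2}\big(\int_1^r s\rho_1(s)\,ds\big)\,r\,dr\,d\theta=1$, where $\phi_{\rho_1}(r,\theta)=(r,\theta+\rho_1(r))$. Put $\rho=\rho_k$ on $[2^{-k},2^{-(k-1)}]$ for every $k\ge1$, and let $\phi_\rho(r,\theta)=(r,\theta+\rho(r))$, $\phi_\rho(0)=0$. **Theorem 7.5.** Suppose that (Fathi's conjecture) $\operatorname{Cal}$ extends to a homomorphism $\overline{\operatorname{Cal}}:Hameo(D^2,\partial D^2)\to\mathbb R$ which is continuous in the Hamiltonian topology. Then, for every choice of such functions $\rho_k$,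 the homeomorphism $\phi_\rho$ belongs to $Sympeo(D^2,\partial D^2)$ but not to $Hameo(D^2,\partial D^2)$. Hence $Hameo(D^2,\partial D^2)$ is a proper normal subgroup of the group $Sympeo(D^2,\partial D^2)$. -/

import Mathlib

open scoped ContDiff UniformConvergence

namespace DiscHam

/-! ### Conventions

`D²` is the closed unit disc of `ℂ = ℝ²`.  All maps and functions on `D²` considered here are
trivial (the identity, respectively zero) outside a compact subset of the open disc.  Such a
homeomorphism of `D²` is the same thing as a homeomorphism of `ℂ` which is the identity outside
that compact set, and similarly for functions, so everything is written on `ℂ`. -/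

/-- The compact subsets of the interior of the unit disc. -/
abbrev IntCompact : Type := {K : Set ℂ // IsCompact K ∧ K ⊆ Metric.ball (0 : ℂ) 1}

/-- The standard area form `ω = dx ∧ dy = r dr ∧ dθ`. -/
def areaForm (u v : ℂ) : ℝ := u.re * v.im - u.im * v.re

/-- The Hamiltonian vector field of `h`, characterised by `dh = X_h ⌟ ω`. -/
noncomputable def hamField (h : ℂ → ℝ) (z : ℂ) : ℂ :=
  ⟨fderiv ℝ h z Complex.I, -fderiv ℝ h z 1⟩

/-- The defining equation `dh(v) = ω(X_h, v)`. -/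
theorem areaForm_hamField (h : ℂ → ℝ) (z v : ℂ) :
    areaForm (hamField h z) v = fderiv ℝ h z v := by
  have hv : v = v.re • (1 : ℂ) + v.im • Complex.I := by
    apply Complex.ext <;> simp
  conv_rhs => rw [hv, map_add, map_smul, map_smul]
  simp only [areaForm, hamField, smul_eq_mul]
  ring

/-! ### Symplectic homeomorphisms -/

/-- Smooth symplectic (= area form preserving) diffeomorphisms supported in `K`. -/
def symp (K : IntCompact) : Set (ℂ ≃ₜ ℂ) :=
  {φ | ContDiff ℝ ∞ φ ∧ ContDiff ℝ ∞ φ.symm ∧ (∀ z, z ∉ K.1 → φ z = z) ∧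
    ∀ z u v, areaForm (fderiv ℝ φ z u) (fderiv ℝ φ z v) = areaForm u v}

/-- A homeomorphism together with its inverse, in the space of functions with the uniformity of
uniform convergence: this induces the metric
`max (sup_z |φ z - ψ z|) (sup_z |φ⁻¹ z - ψ⁻¹ z|)`. -/
noncomputable def homeoGraph (φ : ℂ ≃ₜ ℂ) : ℂ →ᵤ ℂ × ℂ :=
  UniformFun.ofFun fun z => (φ z, φ.symm z)

/-- `Sympeo(D², ∂D²)`: the `C⁰`-limits of symplectic diffeomorphisms supported in a common compact
subset of the open disc. -/
def sympeo : Set (ℂ ≃ₜ ℂ) :=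
  {φ | ∃ K : IntCompact, homeoGraph φ ∈ closure (homeoGraph '' symp K)}

/-! ### Continuous Hamiltonian paths -/

/-- A path of homeomorphisms parametrised by `[0,1]`, paired with a time dependent function. -/
structure PathHam where
  path : unitInterval → (ℂ ≃ₜ ℂ)
  ham : unitInterval → ℂ → ℝ

/-- The pair `(λ, H)` as the function `(t, z) ↦ (λ_t z, λ_t⁻¹ z, H_t z)`, in the space of functions
with the uniformity of uniform convergence. -/
noncomputable def PathHam.unfold (p : PathHam) : (unitInterval × ℂ) →ᵤ (ℂ × ℂ × ℝ) :=
  UniformFun.ofFun fun q => (p.path q.1 q.2, (p.path q.1).symm q.2, p.ham q.1 q.2)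

/-- The `L^∞` Hamiltonian topology: uniform convergence of the paths, of their inverses and of the
Hamiltonians.  (For functions vanishing outside the disc, the supremum norm and the oscillation
norm `max_t osc H_t` are equivalent.) -/
noncomputable instance : TopologicalSpace PathHam := TopologicalSpace.induced PathHam.unfold inferInstance

/-- The smooth Hamiltonian paths supported in `K`, paired with their generating Hamiltonians:
`t ↦ Φ t` is a smooth isotopy with `Φ 0 = id` and `d/dt Φ_t = X_{H_t} ∘ Φ_t`, for a smooth `H` which
vanishes outside `K` (a function smooth on `[0,1] × D²` is the restriction of one smooth for all
times).  The generating Hamiltonian is unique. -/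
def smoothPairs (K : IntCompact) : Set PathHam :=
  {p | ∃ (Φ : ℝ → (ℂ ≃ₜ ℂ)) (H : ℝ → ℂ → ℝ),
    ContDiff ℝ ∞ (fun q : ℝ × ℂ => H q.1 q.2) ∧
    (∀ t z, z ∉ K.1 → H t z = 0) ∧
    ContDiff ℝ ∞ (fun q : ℝ × ℂ => Φ q.1 q.2) ∧
    ContDiff ℝ ∞ (fun q : ℝ × ℂ => (Φ q.1).symm q.2) ∧
    (∀ z, Φ 0 z = z) ∧
    (∀ t z, HasDerivAt (fun s => Φ s z) (hamField (H t) (Φ t z)) t) ∧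
    (∀ t : unitInterval, p.path t = Φ t) ∧
    (∀ t : unitInterval, p.ham t = H t)}

/-- The continuous Hamiltonian paths supported in `K`, paired with their continuous Hamiltonians:
Hamiltonian limits of smooth Hamiltonian paths supported in `K`. -/
def contPairs (K : IntCompact) : Set PathHam := closure (smoothPairs K)

/-- `Hameo(D², ∂D²)`: the time-one maps of continuous Hamiltonian paths. -/
def hameo : Set (ℂ ≃ₜ ℂ) :=
  {φ | ∃ K : IntCompact, ∃ p ∈ contPairs K, p.path 1 = φ}

/-- Evaluation at time one. -/
def ev1 (K : IntCompact) (p : contPairs K) : hameo := ⟨p.1.path 1, K, p.1, p.2, rfl⟩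

/-- The Hamiltonian topology of `Hameo(D², ∂D²)`: the strongest topology for which all the
evaluation maps at time one are continuous. -/
@[reducible] noncomputable def hamTopology : TopologicalSpace hameo :=
  ⨆ K : IntCompact, TopologicalSpace.coinduced (ev1 K) inferInstance

/-! ### The Calabi homomorphism and its extension -/

/-- The Calabi integral `∫₀¹ ∫_{D²} H_t ω dt` of a Hamiltonian. -/
noncomputable def calPath (H : unitInterval → ℂ → ℝ) : ℝ :=
  ∫ t, ∫ z in Metric.closedBall (0 : ℂ) 1, H t z

/-- Fathi's conjecture: the Calabi homomorphism `Cal(φ_H¹) = ∫₀¹ ∫_{D²} H_t ω dt` of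
`Ham(D², ∂D²)` extends to a homomorphism `Hameo(D², ∂D²) → ℝ` which is continuous in the
Hamiltonian topology. -/
def CalabiExtends : Prop :=
  ∃ f : hameo → ℝ,
    (∀ φ ψ χ : hameo, (χ : ℂ ≃ₜ ℂ) = (φ : ℂ ≃ₜ ℂ) * (ψ : ℂ ≃ₜ ℂ) → f χ = f φ + f ψ) ∧
    (∀ K : IntCompact, ∀ p ∈ smoothPairs K, ∀ φ : hameo,
      (φ : ℂ ≃ₜ ℂ) = p.path 1 → f φ = calPath p.ham) ∧
    @Continuous _ _ hamTopology _ f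

/-! ### The infinite twist -/

/-- The autonomous Hamiltonian `F(r, θ) = -∫₁^r s σ(s) ds` generating the twist
`(r, θ) ↦ (r, θ + σ(r))`. -/
noncomputable def twistHam (σ : ℝ → ℝ) (z : ℂ) : ℝ := -∫ s in (1 : ℝ)..‖z‖, s * σ s

/-- The dyadic twist profiles; `ρ j` is the piece living on the annulus
`1/2^(j+1) < r < 1/2^j`, and the first piece has Calabi invariant `1`. -/
structure DyadicProfile (ρ : ℕ → ℝ → ℝ) : Prop where
  smooth : ∀ j, ContDiff ℝ ∞ (ρ j)
  nonneg : ∀ j r, 0 ≤ ρ j r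
  supp : ∀ j, tsupport (ρ j) ⊆ Set.Ioo ((1 / 2 : ℝ) ^ (j + 1)) ((1 / 2 : ℝ) ^ j)
  scaling : ∀ j, ∀ r ∈ Set.Ioo ((1 / 2 : ℝ) ^ (j + 2)) ((1 / 2 : ℝ) ^ (j + 1)),
    ρ (j + 1) r = 2 ^ 4 * ρ j (2 * r)
  calabi : ∫ z in Metric.closedBall (0 : ℂ) 1, twistHam (ρ 0) z = 1

/-- The total twist profile: it equals `ρ j` on the `j`-th dyadic interval. -/
noncomputable def totalProfile (ρ : ℕ → ℝ → ℝ) (r : ℝ) : ℝ := ∑ᶠ j, ρ j r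

theorem DyadicProfile.eq_zero {ρ : ℕ → ℝ → ℝ} (h : DyadicProfile ρ) {j : ℕ} {r : ℝ}
    (hr : r ∉ Set.Ioo ((1 / 2 : ℝ) ^ (j + 1)) ((1 / 2 : ℝ) ^ j)) : ρ j r = 0 :=
  image_eq_zero_of_notMem_tsupport fun hm => hr (h.supp j hm)

theorem DyadicProfile.continuousOn {ρ : ℕ → ℝ → ℝ} (h : DyadicProfile ρ) :
    ContinuousOn (totalProfile ρ) (Set.Ioi 0) := by
  intro r hr
  obtain ⟨n, hn⟩ := exists_pow_lt_of_lt_one (Set.mem_Ioi.1 hr) (by norm_num : (1 / 2 : ℝ) < 1)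
  apply ContinuousAt.continuousWithinAt
  have hc : ContinuousAt (fun s => ∑ j ∈ Finset.range n, ρ j s) r :=
    (continuous_finsetSum _ fun j _ => (h.smooth j).continuous).continuousAt
  refine hc.congr ?_
  filter_upwards [lt_mem_nhds hn] with s hs
  symm
  refine finsum_eq_sum_of_support_subset _ fun j hj => ?_
  simp only [Finset.coe_range, Set.mem_Iio]
  by_contra hjn
  refine hj (h.eq_zero fun hm => ?_)
  have : (1 / 2 : ℝ) ^ j ≤ (1 / 2 : ℝ) ^ n :=
    pow_le_pow_of_le_one (by norm_num) (by norm_num) (not_lt.1 hjn)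
  linarith [hm.2]

/-- On the `j`-th dyadic interval the total profile is `ρ j`. -/
theorem DyadicProfile.totalProfile_eq {ρ : ℕ → ℝ → ℝ} (h : DyadicProfile ρ) {j : ℕ} {r : ℝ}
    (hr : r ∈ Set.Icc ((1 / 2 : ℝ) ^ (j + 1)) ((1 / 2 : ℝ) ^ j)) : totalProfile ρ r = ρ j r := by
  refine finsum_eq_single _ j fun i hij => h.eq_zero fun hm => ?_
  rcases lt_or_gt_of_ne hij with hlt | hlt
  · have : (1 / 2 : ℝ) ^ j ≤ (1 / 2 : ℝ) ^ (i + 1) :=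
      pow_le_pow_of_le_one (by norm_num) (by norm_num) hlt
    linarith [hm.1, hr.2]
  · have : (1 / 2 : ℝ) ^ i ≤ (1 / 2 : ℝ) ^ (j + 1) :=
      pow_le_pow_of_le_one (by norm_num) (by norm_num) hlt
    linarith [hm.2, hr.1]

/-- The map `(r, θ) ↦ (r, θ + σ(r))`, fixing the origin. -/
noncomputable def twistFun (σ : ℝ → ℝ) (z : ℂ) : ℂ := z * Complex.exp (σ ‖z‖ * Complex.I)

theorem norm_twistFun (σ : ℝ → ℝ) (z : ℂ) : ‖twistFun σ z‖ = ‖z‖ := by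
  rw [twistFun, norm_mul, Complex.norm_exp_ofReal_mul_I, mul_one]

theorem twistFun_neg (σ : ℝ → ℝ) (z : ℂ) : twistFun (-σ) (twistFun σ z) = z := by
  conv_lhs => rw [twistFun, norm_twistFun, twistFun]
  rw [mul_assoc, ← Complex.exp_add]
  simp

theorem continuous_twistFun {σ : ℝ → ℝ} (hσ : ContinuousOn σ (Set.Ioi 0)) :
    Continuous (twistFun σ) := by
  rw [continuous_iff_continuousAt]
  intro z
  by_cases hz : z = 0
  · subst hz
    have h0 : twistFun σ 0 = 0 := by simp [twistFun]
    rw [ContinuousAt, h0]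
    refine squeeze_zero_norm (fun w => (norm_twistFun σ w).le) ?_
    simpa using (continuous_norm (E := ℂ)).tendsto 0
  · have h1 : ContinuousAt σ ‖z‖ := hσ.continuousAt (Ioi_mem_nhds (norm_pos_iff.2 hz))
    have h2 : ContinuousAt (fun w : ℂ => σ ‖w‖) z :=
      ContinuousAt.comp (f := fun w : ℂ => ‖w‖) h1 continuous_norm.continuousAt
    unfold twistFun
    fun_prop

/-- The twist homeomorphism of a profile which is continuous away from the origin. -/
noncomputable def twist (σ : ℝ → ℝ) (hσ : ContinuousOn σ (Set.Ioi 0)) : ℂ ≃ₜ ℂ where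
  toFun := twistFun σ
  invFun := twistFun (-σ)
  left_inv := twistFun_neg σ
  right_inv z := by simpa using twistFun_neg (-σ) z
  continuous_toFun := continuous_twistFun hσ
  continuous_invFun := continuous_twistFun hσ.neg

/-- The infinite twist `φ_ρ`. -/
noncomputable def infTwist {ρ : ℕ → ℝ → ℝ} (h : DyadicProfile ρ) : ℂ ≃ₜ ℂ :=
  twist (totalProfile ρ) h.continuousOn

end DiscHam

namespace DiscHam

open Filter Topology Set

/-! ### Uniform convergence and composition -/

/-! Let τ be the twist by the outermost piece `ρ 0`, of Calabi invariant 1, and let δ be the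
dilation z ↦ 2z. The scaling rule gives ρ(r) = ρ₀(r) + 16 ρ(2r), so the infinite twist satisfies φ =
τ ∘ (δ⁻¹ φ¹⁶ δ) (`infTwist_eq_mul`). Conjugation by δ divides the Calabi invariant of a smooth path
by 16: the Hamiltonian becomes H∘δ/4, and the change of variables costs another factor 4. Since the
evaluation maps are continuous for the Hamiltonian topology, a continuous extension f obeys the same
rule on all of Hameo (`calabi_conj_dilation`). If φ were in Hameo, then f(φ) = 1 + 16 f(φ)/16 = 1 +
f(φ), which is absurd.

Membership in Sympeo is soft. A truncated twist is smooth and agrees with φ outside the disc of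
radius 2⁻ⁿ; inside it both maps preserve the norm, so they differ by at most 2·2⁻ⁿ however large ρ
is (`infTwist_mem_sympeo`).

For the group structure and normality, products, inverses and conjugates of smooth Hamiltonian paths
have Hamiltonians given by formulas that involve compositions but no derivatives (`SmoothIso.mul`,
`SmoothIso.inv`, `SmoothIso.conj`). Such formulas pass to uniform limits, because the limits are
uniformly continuous. Conjugation by a symplectic homeomorphism approximates the path and the
conjugator simultaneously (`conj_mem_hameo`). Properness also needs some dyadic profile to exist
(`exists_dyadicProfile`). -/

theorem tendstoUniformly_comp₂ {ι α β γ : Type*} [UniformSpace β] [UniformSpace γ] {l : Filter ι}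
    {F : ι → β → γ} {f : β → γ} {G : ι → α → β} {g : α → β} (hF : TendstoUniformly F f l)
    (hf : UniformContinuous f) (hG : TendstoUniformly G g l) :
    TendstoUniformly (fun i x => F i (G i x)) (fun x => f (g x)) l := by
  intro u hu
  obtain ⟨v, hv, hvu⟩ := comp_mem_uniformity_sets hu
  filter_upwards [hF v hv, (hf.comp_tendstoUniformly hG) v hv] with i h1 h2 x
  exact hvu ⟨f (G i x), h2 x, h1 _⟩

theorem tendstoUniformly_prodMk {ι α β γ : Type*} [UniformSpace β] [UniformSpace γ] {l : Filter ι}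
    {F : ι → α → β} {f : α → β} {G : ι → α → γ} {g : α → γ} :
    TendstoUniformly (fun i x => (F i x, G i x)) (fun x => (f x, g x)) l ↔
      TendstoUniformly F f l ∧ TendstoUniformly G g l := by
  constructor
  · intro h
    exact ⟨uniformContinuous_fst.comp_tendstoUniformly h,
      uniformContinuous_snd.comp_tendstoUniformly h⟩
  · rintro ⟨h1, h2⟩ u hu
    obtain ⟨s, hs, t, ht, hst⟩ := entourageProd_subset hu
    filter_upwards [h1 s hs, h2 t ht] with i h3 h4 x
    exact hst ⟨h3 x, h4 x⟩

theorem tendstoUniformly_const {ι α β : Type*} [UniformSpace β] {l : Filter ι} (f : α → β) :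
    TendstoUniformly (fun _ : ι => f) f l :=
  fun _ hu => Eventually.of_forall fun _ _ => refl_mem_uniformity hu

/-- The trace on `S` of the pulled-back neighbourhood filter. It lets closure arguments run as
limits along a filter on `X` itself, and two such limits combine along a product filter. -/
theorem exists_filter_of_mem_closure_image {X Y : Type*} [TopologicalSpace Y] {f : X → Y}
    {S : Set X} {x : X} (h : f x ∈ closure (f '' S)) :
    ∃ l : Filter X, l.NeBot ∧ S ∈ l ∧ Tendsto f l (𝓝 (f x)) := by
  refine ⟨comap f (𝓝 (f x)) ⊓ 𝓟 S, ?_, mem_inf_of_right (mem_principal_self S),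
    tendsto_comap.mono_left inf_le_left⟩
  rw [inf_neBot_iff]
  intro s hs t ht
  obtain ⟨u, hu, hus⟩ := mem_comap.1 hs
  obtain ⟨_, hyu, y, hyS, rfl⟩ := mem_closure_iff_nhds.1 h u hu
  exact ⟨y, hus hyu, ht hyS⟩

theorem mem_closure_image_of_tendsto {ι X Y : Type*} [TopologicalSpace Y] {f : X → Y}
    {S : Set X} {x : X} {l : Filter ι} [l.NeBot] {F : ι → X} (hF : ∀ᶠ i in l, F i ∈ S)
    (h : Tendsto (fun i => f (F i)) l (𝓝 (f x))) : f x ∈ closure (f '' S) :=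
  mem_closure_of_tendsto h (hF.mono fun _ hi => mem_image_of_mem f hi)

/-! ### Convergence of homeomorphisms -/

/-- Uniform convergence of homeomorphisms and of their inverses. -/
structure HomeoTendsto {ι : Type*} (F : ι → (ℂ ≃ₜ ℂ)) (l : Filter ι) (φ : ℂ ≃ₜ ℂ) : Prop where
  fwd : TendstoUniformly (fun i => ⇑(F i)) φ l
  bwd : TendstoUniformly (fun i => ⇑(F i).symm) φ.symm l

theorem tendsto_homeoGraph_iff {ι : Type*} {F : ι → (ℂ ≃ₜ ℂ)} {l : Filter ι} {φ : ℂ ≃ₜ ℂ} :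
    Tendsto (fun i => homeoGraph (F i)) l (𝓝 (homeoGraph φ)) ↔ HomeoTendsto F l φ := by
  rw [UniformFun.tendsto_iff_tendstoUniformly]
  exact tendstoUniformly_prodMk.trans ⟨fun h => ⟨h.1, h.2⟩, fun h => ⟨h.fwd, h.bwd⟩⟩

/-- Homeomorphisms which are uniformly continuous together with their inverses. -/
structure HomeoUnif (φ : ℂ ≃ₜ ℂ) : Prop where
  fwd : UniformContinuous φ
  bwd : UniformContinuous φ.symm

theorem HomeoUnif.of_tendsto {ι : Type*} {F : ι → (ℂ ≃ₜ ℂ)} {l : Filter ι} [l.NeBot] {φ : ℂ ≃ₜ ℂ}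
    (h : HomeoTendsto F l φ) (hF : ∀ᶠ i in l, HomeoUnif (F i)) : HomeoUnif φ :=
  ⟨h.fwd.uniformContinuous (hF.mono fun _ hi => hi.fwd).frequently,
    h.bwd.uniformContinuous (hF.mono fun _ hi => hi.bwd).frequently⟩

theorem HomeoTendsto.comp {ι κ : Type*} {F : ι → (ℂ ≃ₜ ℂ)} {l : Filter ι} {φ : ℂ ≃ₜ ℂ}
    (h : HomeoTendsto F l φ) {l' : Filter κ} {a : κ → ι} (ha : Tendsto a l' l) :
    HomeoTendsto (fun k => F (a k)) l' φ :=
  ⟨fun u hu => ha.eventually (h.fwd u hu), fun u hu => ha.eventually (h.bwd u hu)⟩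

theorem HomeoTendsto.inv {ι : Type*} {F : ι → (ℂ ≃ₜ ℂ)} {l : Filter ι} {φ : ℂ ≃ₜ ℂ}
    (h : HomeoTendsto F l φ) : HomeoTendsto (fun i => (F i)⁻¹) l φ⁻¹ := ⟨h.bwd, h.fwd⟩

/-- Only the limits need to be uniformly continuous; the approximants enter through uniform
convergence alone. -/
theorem HomeoTendsto.mul {ι : Type*} {F G : ι → (ℂ ≃ₜ ℂ)} {l : Filter ι} {φ ψ : ℂ ≃ₜ ℂ}
    (h : HomeoTendsto F l φ) (h' : HomeoTendsto G l ψ) (hφ : HomeoUnif φ) (hψ : HomeoUnif ψ) :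
    HomeoTendsto (fun i => F i * G i) l (φ * ψ) :=
  ⟨(tendstoUniformly_comp₂ h.fwd hφ.fwd h'.fwd :), (tendstoUniformly_comp₂ h'.bwd hψ.bwd h.bwd :)⟩

/-! ### Convergence of paths paired with functions -/

namespace PathHam

/-- The map `(t, z) ↦ λ_t z`. -/
noncomputable def fwd (p : PathHam) (q : unitInterval × ℂ) : ℂ := p.path q.1 q.2

/-- The map `(t, z) ↦ λ_t⁻¹ z`. -/
noncomputable def bwd (p : PathHam) (q : unitInterval × ℂ) : ℂ := (p.path q.1).symm q.2

/-- The map `(t, z) ↦ H_t z`. -/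
def fn (p : PathHam) (q : unitInterval × ℂ) : ℝ := p.ham q.1 q.2

/-- Convergence in the Hamiltonian topology, in components. -/
structure Tends {ι : Type*} (F : ι → PathHam) (l : Filter ι) (p : PathHam) : Prop where
  fwd : TendstoUniformly (fun i => (F i).fwd) p.fwd l
  bwd : TendstoUniformly (fun i => (F i).bwd) p.bwd l
  fn : TendstoUniformly (fun i => (F i).fn) p.fn l

theorem tendsto_unfold_iff {ι : Type*} {F : ι → PathHam} {l : Filter ι} {p : PathHam} :
    Tendsto (fun i => (F i).unfold) l (𝓝 p.unfold) ↔ Tends F l p := by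
  rw [UniformFun.tendsto_iff_tendstoUniformly]
  refine tendstoUniformly_prodMk.trans ((and_congr_right' tendstoUniformly_prodMk).trans ?_)
  exact ⟨fun h => ⟨h.1, h.2.1, h.2.2⟩, fun h => ⟨h.fwd, h.bwd, h.fn⟩⟩

theorem tendsto_iff {ι : Type*} {F : ι → PathHam} {l : Filter ι} {p : PathHam} :
    Tendsto F l (𝓝 p) ↔ Tends F l p := by
  rw [nhds_induced, tendsto_comap_iff]
  exact tendsto_unfold_iff

theorem mem_closure_iff_exists_filter {S : Set PathHam} {p : PathHam} (h : p ∈ closure S) :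
    ∃ l : Filter PathHam, l.NeBot ∧ S ∈ l ∧ Tends (fun q => q) l p := by
  obtain ⟨l, h1, h2, h3⟩ := exists_filter_of_mem_closure_image (closure_induced.1 h)
  exact ⟨l, h1, h2, tendsto_unfold_iff.1 h3⟩

theorem Tends.mem_closure {ι : Type*} {F : ι → PathHam} {l : Filter ι} [l.NeBot] {p : PathHam}
    (h : Tends F l p) {S : Set PathHam} (hF : ∀ᶠ i in l, F i ∈ S) : p ∈ closure S :=
  mem_closure_of_tendsto (tendsto_iff.2 h) hF

/-- Joint uniform continuity of the path, of its inverse, and of the function. -/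
structure Unif (p : PathHam) : Prop where
  fwd : UniformContinuous p.fwd
  bwd : UniformContinuous p.bwd
  fn : UniformContinuous p.fn

theorem Unif.of_tends {ι : Type*} {F : ι → PathHam} {l : Filter ι} [l.NeBot] {p : PathHam}
    (h : Tends F l p) (hF : ∀ᶠ i in l, (F i).Unif) : p.Unif :=
  ⟨h.fwd.uniformContinuous (hF.mono fun _ hi => hi.fwd).frequently,
    h.bwd.uniformContinuous (hF.mono fun _ hi => hi.bwd).frequently,
    h.fn.uniformContinuous (hF.mono fun _ hi => hi.fn).frequently⟩

theorem Tends.comp {ι κ : Type*} {F : ι → PathHam} {l : Filter ι} {p : PathHam}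
    (h : Tends F l p) {l' : Filter κ} {a : κ → ι} (ha : Tendsto a l' l) :
    Tends (fun k => F (a k)) l' p :=
  ⟨fun u hu => ha.eventually (h.fwd u hu), fun u hu => ha.eventually (h.bwd u hu),
    fun u hu => ha.eventually (h.fn u hu)⟩

/-- The product path `λ_t ∘ μ_t`, paired with `H_t + K_t ∘ λ_t⁻¹`. -/
protected noncomputable def mul (p q : PathHam) : PathHam where
  path t := p.path t * q.path t
  ham t z := p.ham t z + q.ham t ((p.path t).symm z)

/-- The inverse path `λ_t⁻¹`, paired with `-H_t ∘ λ_t`. -/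
protected noncomputable def inv (p : PathHam) : PathHam where
  path t := (p.path t)⁻¹
  ham t z := -p.ham t (p.path t z)

/-- The conjugated path `ψ⁻¹ ∘ λ_t ∘ ψ`, paired with `c⁻¹ H_t ∘ ψ`. -/
protected noncomputable def conj (c : ℝ) (ψ : ℂ ≃ₜ ℂ) (p : PathHam) : PathHam where
  path t := ψ⁻¹ * p.path t * ψ
  ham t z := c⁻¹ * p.ham t (ψ z)

theorem tendstoUniformly_time {ι : Type*} {l : Filter ι} {F : ι → unitInterval × ℂ → ℂ}
    {f : unitInterval × ℂ → ℂ} (h : TendstoUniformly F f l) :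
    TendstoUniformly (fun i (q : unitInterval × ℂ) => (q.1, F i q)) (fun q => (q.1, f q)) l :=
  tendstoUniformly_prodMk.2 ⟨tendstoUniformly_const _, h⟩

theorem tendstoUniformly_slice {ι : Type*} {l : Filter ι} {F : ι → ℂ → ℂ}
    {f : ℂ → ℂ} (h : TendstoUniformly F f l) :
    TendstoUniformly (fun i (q : unitInterval × ℂ) => F i q.2) (fun q => f q.2) l :=
  h.comp Prod.snd

theorem Tends.mul {ι : Type*} {F G : ι → PathHam} {l : Filter ι} {p q : PathHam}
    (h : Tends F l p) (h' : Tends G l q) (hp : p.Unif) (hq : q.Unif) :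
    Tends (fun i => (F i).mul (G i)) l (p.mul q) where
  fwd := (tendstoUniformly_comp₂ h.fwd hp.fwd (tendstoUniformly_time h'.fwd) :)
  bwd := (tendstoUniformly_comp₂ h'.bwd hq.bwd (tendstoUniformly_time h.bwd) :)
  fn := uniformContinuous_add.comp_tendstoUniformly (tendstoUniformly_prodMk.2
    ⟨h.fn, tendstoUniformly_comp₂ h'.fn hq.fn (tendstoUniformly_time h.bwd)⟩)

theorem Tends.inv {ι : Type*} {F : ι → PathHam} {l : Filter ι} {p : PathHam}
    (h : Tends F l p) (hp : p.Unif) : Tends (fun i => (F i).inv) l p.inv where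
  fwd := h.bwd
  bwd := h.fwd
  fn := uniformContinuous_neg.comp_tendstoUniformly
    (tendstoUniformly_comp₂ h.fn hp.fn (tendstoUniformly_time h.fwd))

theorem Tends.conj {ι : Type*} (c : ℝ) {F : ι → PathHam} {G : ι → (ℂ ≃ₜ ℂ)} {l : Filter ι}
    {p : PathHam} {ψ : ℂ ≃ₜ ℂ} (h : Tends F l p) (h' : HomeoTendsto G l ψ) (hp : p.Unif)
    (hψ : HomeoUnif ψ) : Tends (fun i => (F i).conj c (G i)) l (p.conj c ψ) where
  fwd := (tendstoUniformly_comp₂ h'.bwd hψ.bwd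
    (tendstoUniformly_comp₂ h.fwd hp.fwd (tendstoUniformly_time (tendstoUniformly_slice h'.fwd))) :)
  bwd := (tendstoUniformly_comp₂ h'.bwd hψ.bwd
    (tendstoUniformly_comp₂ h.bwd hp.bwd (tendstoUniformly_time (tendstoUniformly_slice h'.fwd))) :)
  fn := (uniformContinuous_const_smul c⁻¹).comp_tendstoUniformly
    (tendstoUniformly_comp₂ h.fn hp.fn (tendstoUniformly_time (tendstoUniformly_slice h'.fwd)))

theorem Tends.eval {ι : Type*} {F : ι → PathHam} {l : Filter ι} {p : PathHam}
    (h : Tends F l p) (t : unitInterval) : HomeoTendsto (fun i => (F i).path t) l (p.path t) :=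
  ⟨h.fwd.comp fun z => (t, z), h.bwd.comp fun z => (t, z)⟩

end PathHam

/-! ### Uniform continuity of compactly supported perturbations of the identity -/

theorem uniformContinuous_of_vanish {E : Type*} [NormedAddCommGroup E] {K : Set ℂ}
    (hK : IsCompact K) {f : unitInterval × ℂ → E} (hf : Continuous f)
    (h : ∀ t, ∀ z, z ∉ K → f (t, z) = 0) : UniformContinuous f := by
  refine HasCompactSupport.uniformContinuous_of_continuous ?_ hf
  refine HasCompactSupport.intro (isCompact_univ.prod hK : IsCompact (univ ×ˢ K)) ?_
  rintro ⟨t, z⟩ hz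
  exact h t z fun hm => hz ⟨mem_univ _, hm⟩

theorem uniformContinuous_of_eq_id {K : Set ℂ} (hK : IsCompact K) {f : unitInterval × ℂ → ℂ}
    (hf : Continuous f) (h : ∀ t, ∀ z, z ∉ K → f (t, z) = z) : UniformContinuous f := by
  have h1 : UniformContinuous fun q : unitInterval × ℂ => f q - q.2 :=
    uniformContinuous_of_vanish hK (hf.sub continuous_snd) fun t z hz => by simp [h t z hz]
  simpa using h1.add uniformContinuous_snd

theorem symm_eq_of_eq_id {K : Set ℂ} {φ : ℂ ≃ₜ ℂ} (h : ∀ z, z ∉ K → φ z = z) {z : ℂ}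
    (hz : z ∉ K) : φ.symm z = z := by
  rw [Homeomorph.symm_apply_eq, h z hz]

theorem HomeoUnif.of_eq_id {K : Set ℂ} (hK : IsCompact K) {φ : ℂ ≃ₜ ℂ}
    (h : ∀ z, z ∉ K → φ z = z) : HomeoUnif φ := by
  have key : ∀ f : ℂ → ℂ, Continuous f → (∀ z, z ∉ K → f z = z) → UniformContinuous f := by
    intro f hf h
    -- A dummy time variable reduces the claim to the version for paths.
    have h1 : UniformContinuous fun q : unitInterval × ℂ => f q.2 :=
      uniformContinuous_of_eq_id hK (hf.comp continuous_snd) fun t z hz => h z hz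
    exact h1.comp ((uniformContinuous_const (b := (0 : unitInterval))).prodMk uniformContinuous_id)
  exact ⟨key _ φ.continuous h, key _ φ.symm.continuous fun z hz => symm_eq_of_eq_id h hz⟩

/-! ### Linear algebra of the area form -/

theorem areaForm_ext {u v : ℂ} (h : ∀ w, areaForm u w = areaForm v w) : u = v := by
  apply Complex.ext
  · simpa [areaForm] using h Complex.I
  · simpa [areaForm] using h 1

theorem areaForm_zero_left (w : ℂ) : areaForm 0 w = 0 := by simp [areaForm]

theorem injective_of_areaForm {A : ℂ →L[ℝ] ℂ} {c : ℝ} (hc : c ≠ 0)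
    (hA : ∀ u v, areaForm (A u) (A v) = c * areaForm u v) : Function.Injective A := by
  intro u v huv
  rw [← sub_eq_zero]
  refine areaForm_ext fun w => ?_
  have h := hA (u - v) w
  rw [map_sub, huv, sub_self, areaForm_zero_left] at h
  rw [areaForm_zero_left]
  exact (mul_eq_zero.1 h.symm).resolve_left hc

/-- Naturality of Hamiltonian fields under a conformally symplectic map: pairing both sides by ω
with Dφ·v gives dh(Dφ·v), and the factor c⁻¹ cancels the conformal factor. Since Dφ is onto,
nondegeneracy finishes. -/
theorem hamField_comp {φ : ℂ → ℂ} {h : ℂ → ℝ} {w : ℂ} {c : ℝ} (hc : c ≠ 0)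
    (hφ : DifferentiableAt ℝ φ w) (hh : DifferentiableAt ℝ h (φ w))
    (hA : ∀ u v, areaForm (fderiv ℝ φ w u) (fderiv ℝ φ w v) = c * areaForm u v) :
    fderiv ℝ φ w (hamField (fun z => c⁻¹ * h (φ z)) w) = hamField h (φ w) := by
  have hinj := injective_of_areaForm hc hA
  have hsurj : Function.Surjective (fderiv ℝ φ w) :=
    (LinearMap.injective_iff_surjective (f := (fderiv ℝ φ w).toLinearMap)).1 hinj
  refine areaForm_ext fun b => ?_
  obtain ⟨v, rfl⟩ := hsurj b
  rw [hA, areaForm_hamField, areaForm_hamField]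
  have hd : HasFDerivAt (fun z => c⁻¹ * h (φ z))
      (c⁻¹ • ((fderiv ℝ h (φ w)).comp (fderiv ℝ φ w))) w :=
    (hh.hasFDerivAt.comp w hφ.hasFDerivAt).const_mul c⁻¹
  rw [hd.fderiv]
  simp [hc]

theorem hamField_add {f g : ℂ → ℝ} {z : ℂ} (hf : DifferentiableAt ℝ f z)
    (hg : DifferentiableAt ℝ g z) :
    hamField (fun w => f w + g w) z = hamField f z + hamField g z := by
  have : fderiv ℝ (fun w => f w + g w) z = fderiv ℝ f z + fderiv ℝ g z := fderiv_fun_add hf hg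
  apply Complex.ext <;> simp [hamField, this]
  ring

theorem hamField_neg (f : ℂ → ℝ) (z : ℂ) : hamField (fun w => -f w) z = -hamField f z := by
  have : fderiv ℝ (fun w => -f w) z = -fderiv ℝ f z := fderiv_fun_neg
  apply Complex.ext <;> simp [hamField, this]

theorem hamField_eq_zero {K : Set ℂ} (hK : IsClosed K) {h : ℂ → ℝ} (hh : ∀ z, z ∉ K → h z = 0)
    {z : ℂ} (hz : z ∉ K) : hamField h z = 0 := by
  have h1 : h =ᶠ[𝓝 z] fun _ => 0 := by
    filter_upwards [hK.isOpen_compl.mem_nhds hz] with w hw using hh w hw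
  have : fderiv ℝ h z = 0 := by rw [h1.fderiv_eq]; simp
  apply Complex.ext <;> simp [hamField, this]

/-- The derivative L of a Hamiltonian field satisfies ω(La, b) = Hess h(a, b), so symmetry of the
Hessian makes L infinitesimally symplectic. -/
theorem hasFDerivAt_hamField {h : ℂ → ℝ} (hh : ContDiff ℝ ∞ h) (z : ℂ) :
    ∃ L : ℂ →L[ℝ] ℂ, HasFDerivAt (hamField h) L z ∧
      ∀ a b, areaForm (L a) b + areaForm a (L b) = 0 := by
  have hd : DifferentiableAt ℝ (fderiv ℝ h) z :=
    ((hh.fderiv_right (m := ∞) (by simp)).differentiable (by simp)) z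
  set B := fderiv ℝ (fderiv ℝ h) z with hB
  have hsymm : ∀ a b, B a b = B b a := hh.contDiffAt.isSymmSndFDerivAt (by
      simpa using WithTop.coe_le_coe.2 (le_top : (2 : ℕ∞) ≤ ⊤))
  have h1 : HasFDerivAt (fun w => fderiv ℝ h w Complex.I) (B.flip Complex.I) z := by
    simpa using hd.hasFDerivAt.clm_apply (hasFDerivAt_const Complex.I z)
  have h2 : HasFDerivAt (fun w => fderiv ℝ h w 1) (B.flip 1) z := by
    simpa using hd.hasFDerivAt.clm_apply (hasFDerivAt_const (1 : ℂ) z)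
  have h3 := Complex.equivRealProdCLM.symm.hasFDerivAt.comp z (h1.prodMk h2.neg)
  refine ⟨_, h3, fun a b => ?_⟩
  have hdec : ∀ v : ℂ, v = v.re • (1 : ℂ) + v.im • Complex.I := fun v => by
    apply Complex.ext <;> simp
  have e1 : B a b = b.re * B a 1 + b.im * B a Complex.I := by
    conv_lhs => rw [hdec b, map_add, map_smul, map_smul]
    rfl
  have e2 : B b a = a.re * B b 1 + a.im * B b Complex.I := by
    conv_lhs => rw [hdec a, map_add, map_smul, map_smul]
    rfl
  have e3 := hsymm a b
  simp [areaForm]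
  linarith

/-! ### Smooth Hamiltonian isotopies -/

/-- `Φ` is the smooth isotopy generated by the smooth Hamiltonian `H`, which vanishes outside `K`. -/
structure SmoothIso (K : IntCompact) (Φ : ℝ → (ℂ ≃ₜ ℂ)) (H : ℝ → ℂ → ℝ) : Prop where
  ham : ContDiff ℝ ∞ (fun q : ℝ × ℂ => H q.1 q.2)
  supp : ∀ t z, z ∉ K.1 → H t z = 0
  fwd : ContDiff ℝ ∞ (fun q : ℝ × ℂ => Φ q.1 q.2)
  bwd : ContDiff ℝ ∞ (fun q : ℝ × ℂ => (Φ q.1).symm q.2)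
  zero : ∀ z, Φ 0 z = z
  deriv : ∀ t z, HasDerivAt (fun s => Φ s z) (hamField (H t) (Φ t z)) t

namespace SmoothIso

variable {K : IntCompact} {Φ : ℝ → (ℂ ≃ₜ ℂ)} {H : ℝ → ℂ → ℝ}

theorem ham_slice (h : SmoothIso K Φ H) (t : ℝ) : ContDiff ℝ ∞ (H t) :=
  h.ham.comp (contDiff_const.prodMk contDiff_id)

theorem fwd_slice (h : SmoothIso K Φ H) (t : ℝ) : ContDiff ℝ ∞ (Φ t) :=
  h.fwd.comp (contDiff_const.prodMk contDiff_id)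

theorem bwd_slice (h : SmoothIso K Φ H) (t : ℝ) : ContDiff ℝ ∞ (Φ t).symm :=
  h.bwd.comp (contDiff_const.prodMk contDiff_id)

theorem ham_diff (h : SmoothIso K Φ H) (t : ℝ) (z : ℂ) : DifferentiableAt ℝ (H t) z :=
  (h.ham_slice t).differentiable (by simp) z

theorem fwd_diff (h : SmoothIso K Φ H) (t : ℝ) (z : ℂ) : DifferentiableAt ℝ (Φ t) z :=
  (h.fwd_slice t).differentiable (by simp) z

theorem fderiv_time (h : SmoothIso K Φ H) (t : ℝ) (z : ℂ) :
    fderiv ℝ (fun q : ℝ × ℂ => Φ q.1 q.2) (t, z) (1, 0) = hamField (H t) (Φ t z) := by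
  have h1 := (h.fwd.differentiable (by simp) (t, z)).hasFDerivAt
  have h2 : HasDerivAt (fun s : ℝ => (s, z)) ((1 : ℝ), (0 : ℂ)) t :=
    (hasDerivAt_id t).prodMk (hasDerivAt_const t z)
  have h3 := h1.comp_hasDerivAt t h2
  exact h3.unique (h.deriv t z)

theorem fderiv_space (h : SmoothIso K Φ H) (t : ℝ) (z u : ℂ) :
    fderiv ℝ (fun q : ℝ × ℂ => Φ q.1 q.2) (t, z) (0, u) = fderiv ℝ (Φ t) z u := by
  have h1 := (h.fwd.differentiable (by simp) (t, z)).hasFDerivAt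
  have h2 : HasFDerivAt (fun w : ℂ => (t, w)) (ContinuousLinearMap.inr ℝ ℝ ℂ) z :=
    hasFDerivAt_prodMk_right t z
  have h3 := (h1.comp z h2).fderiv
  have h4 : fderiv ℝ (Φ t) z = _ := h3
  rw [h4]
  simp

theorem hasDerivAt_comp (h : SmoothIso K Φ H) {t : ℝ} {w : ℝ → ℂ} {w' : ℂ}
    (hw : HasDerivAt w w' t) :
    HasDerivAt (fun s => Φ s (w s)) (hamField (H t) (Φ t (w t)) + fderiv ℝ (Φ t) (w t) w') t := by
  have h1 := (h.fwd.differentiable (by simp) (t, w t)).hasFDerivAt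
  have h2 : HasDerivAt (fun s : ℝ => (s, w s)) ((1 : ℝ), w') t := (hasDerivAt_id t).prodMk hw
  have h3 := h1.comp_hasDerivAt t h2
  have h4 : ((1 : ℝ), w') = (1, 0) + (0, w') := by simp
  rw [h4, map_add, h.fderiv_time, h.fderiv_space] at h3
  exact h3

/-- Hamiltonian isotopies preserve the area form. -/
theorem areaForm_fderiv (h : SmoothIso K Φ H) (t : ℝ) (z u v : ℂ) :
    areaForm (fderiv ℝ (Φ t) z u) (fderiv ℝ (Φ t) z v) = areaForm u v := by
  set P : ℝ × ℂ → ℂ := fun q => Φ q.1 q.2 with hP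
  have hPd : Differentiable ℝ (fderiv ℝ P) :=
    (h.fwd.fderiv_right (m := ∞) (by simp)).differentiable (by simp)
  -- The variational equation: equality of mixed derivatives turns the time derivative of DΦ·u into
  -- L(DΦ·u), with L the derivative of the Hamiltonian field at Φ t z.
  have hA : ∀ t u, ∃ L : ℂ →L[ℝ] ℂ, HasFDerivAt (hamField (H t)) L (Φ t z) ∧
      (∀ a b, areaForm (L a) b + areaForm a (L b) = 0) ∧
      HasDerivAt (fun s => fderiv ℝ (Φ s) z u) (L (fderiv ℝ (Φ t) z u)) t := by
    intro t u
    obtain ⟨L, hL, hLa⟩ := hasFDerivAt_hamField (h.ham_slice t) (Φ t z)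
    refine ⟨L, hL, hLa, ?_⟩
    set B := fderiv ℝ (fderiv ℝ P) (t, z) with hB
    have hsymm : ∀ a b, B a b = B b a := h.fwd.contDiffAt.isSymmSndFDerivAt (by
      simpa using WithTop.coe_le_coe.2 (le_top : (2 : ℕ∞) ≤ ⊤))
    have h1 : HasDerivAt (fun s => fderiv ℝ P (s, z) (0, u)) (B (1, 0) (0, u)) t := by
      have h2 : HasDerivAt (fun s : ℝ => (s, z)) ((1 : ℝ), (0 : ℂ)) t :=
        (hasDerivAt_id t).prodMk (hasDerivAt_const t z)
      have h3 := (hPd (t, z)).hasFDerivAt.comp_hasDerivAt t h2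
      simpa using h3.clm_apply (hasDerivAt_const t ((0 : ℝ), u))
    have h2 : B (0, u) (1, 0) = L (fderiv ℝ (Φ t) z u) := by
      have h3 : HasFDerivAt (fun w : ℂ => (t, w)) (ContinuousLinearMap.inr ℝ ℝ ℂ) z :=
        hasFDerivAt_prodMk_right t z
      have h4 := ((hPd (t, z)).hasFDerivAt.comp z h3).clm_apply
        (hasFDerivAt_const ((1 : ℝ), (0 : ℂ)) z)
      have h5 : HasFDerivAt (fun w => fderiv ℝ P (t, w) (1, 0))
          (L.comp (fderiv ℝ (Φ t) z)) z := by
        have : (fun w => fderiv ℝ P (t, w) (1, 0)) = fun w => hamField (H t) (Φ t w) :=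
          funext fun w => h.fderiv_time t w
        rw [this]
        exact hL.comp z (h.fwd_diff t z).hasFDerivAt
      have h6 := congrArg (fun M : ℂ →L[ℝ] ℂ => M u) (h4.unique h5)
      simpa using h6
    rw [hsymm, h2] at h1
    have : (fun s => fderiv ℝ P (s, z) (0, u)) = fun s => fderiv ℝ (Φ s) z u :=
      funext fun s => h.fderiv_space s z u
    rwa [this] at h1
  have hder : ∀ t, HasDerivAt
      (fun s => areaForm (fderiv ℝ (Φ s) z u) (fderiv ℝ (Φ s) z v)) 0 t := by
    intro t
    obtain ⟨L, hL, hLa, hu⟩ := hA t u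
    obtain ⟨L', hL', -, hv⟩ := hA t v
    -- The two directions must be governed by the same L before infinitesimal symplecticity can be
    -- applied.
    rw [hL'.unique hL] at hv
    have hre : ∀ {f : ℝ → ℂ} {f' : ℂ}, HasDerivAt f f' t → HasDerivAt (fun s => (f s).re) f'.re t :=
      fun hf => Complex.reCLM.hasFDerivAt.comp_hasDerivAt t hf
    have him : ∀ {f : ℝ → ℂ} {f' : ℂ}, HasDerivAt f f' t → HasDerivAt (fun s => (f s).im) f'.im t :=
      fun hf => Complex.imCLM.hasFDerivAt.comp_hasDerivAt t hf
    have key := ((hre hu).mul (him hv)).sub ((him hu).mul (hre hv))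
    refine key.congr_deriv ?_
    have := hLa (fderiv ℝ (Φ t) z u) (fderiv ℝ (Φ t) z v)
    simp only [areaForm] at this
    linarith
  have hconst := is_const_of_deriv_eq_zero (fun t => (hder t).differentiableAt)
    (fun t => (hder t).deriv) t 0
  rw [hconst]
  have h0 : ⇑(Φ 0) = id := funext h.zero
  rw [h0, fderiv_id]
  simp

theorem fderiv_injective (h : SmoothIso K Φ H) (t : ℝ) (z : ℂ) :
    Function.Injective (fderiv ℝ (Φ t) z) :=
  injective_of_areaForm one_ne_zero fun u v => by rw [h.areaForm_fderiv, one_mul]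

theorem hamField_pullback (h : SmoothIso K Φ H) {g : ℂ → ℝ} {t : ℝ} {w : ℂ}
    (hg : DifferentiableAt ℝ g (Φ t w)) :
    fderiv ℝ (Φ t) w (hamField (fun z => g (Φ t z)) w) = hamField g (Φ t w) := by
  simpa using hamField_comp one_ne_zero (h.fwd_diff t w) hg
    fun u v => by rw [h.areaForm_fderiv, one_mul]

/-- Differentiate Φ_s(Φ_s⁻¹ z) = z. The inverse is already known to be smooth, so injectivity of DΦ
identifies its derivative. -/
theorem hasDerivAt_symm (h : SmoothIso K Φ H) (t : ℝ) (z : ℂ) :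
    HasDerivAt (fun s => (Φ s).symm z)
      (hamField (fun w => -H t (Φ t w)) ((Φ t).symm z)) t := by
  have h1 : DifferentiableAt ℝ (fun s => (Φ s).symm z) t :=
    ((h.bwd.comp (contDiff_id.prodMk contDiff_const)).differentiable (by simp)) t
  refine h1.hasDerivAt.congr_deriv (h.fderiv_injective t ((Φ t).symm z) ?_)
  have h2 := h.hasDerivAt_comp h1.hasDerivAt
  simp only [Homeomorph.apply_symm_apply] at h2
  have h3 := h2.unique (hasDerivAt_const t z)
  have h4 := h.hamField_pullback (g := fun w => -H t w) (h.ham_diff t (Φ t ((Φ t).symm z))).neg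
  rw [h4, hamField_neg, Homeomorph.apply_symm_apply]
  exact eq_neg_of_add_eq_zero_right h3

/-- Working with the inverse avoids any uniqueness theorem for ODEs: the velocity of Φ_s⁻¹ z is
carried by DΦ to minus the Hamiltonian field at the fixed point z, which is zero off K. -/
theorem symm_eq (h : SmoothIso K Φ H) (t : ℝ) {z : ℂ} (hz : z ∉ K.1) : (Φ t).symm z = z := by
  have h0 : ∀ t, HasDerivAt (fun s => (Φ s).symm z) 0 t := by
    intro t
    refine (h.hasDerivAt_symm t z).congr_deriv (h.fderiv_injective t ((Φ t).symm z) ?_)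
    have h4 := h.hamField_pullback (g := fun w => -H t w) (h.ham_diff t (Φ t ((Φ t).symm z))).neg
    rw [h4, hamField_neg, Homeomorph.apply_symm_apply,
      hamField_eq_zero K.2.1.isClosed (h.supp t) hz, map_zero, neg_zero]
  rw [is_const_of_deriv_eq_zero (fun t => (h0 t).differentiableAt) (fun t => (h0 t).deriv) t 0,
    Homeomorph.symm_apply_eq, h.zero]

theorem eq_id (h : SmoothIso K Φ H) (t : ℝ) {z : ℂ} (hz : z ∉ K.1) : Φ t z = z := by
  conv_lhs => rw [← h.symm_eq t hz]
  rw [Homeomorph.apply_symm_apply]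

theorem mem_symp (h : SmoothIso K Φ H) (t : ℝ) : Φ t ∈ symp K :=
  ⟨h.fwd_slice t, h.bwd_slice t, fun _ hz => h.eq_id t hz, h.areaForm_fderiv t⟩

theorem mono {K' : IntCompact} (h : SmoothIso K Φ H) (hK : K.1 ⊆ K'.1) : SmoothIso K' Φ H :=
  { h with supp := fun t z hz => h.supp t z fun hm => hz (hK hm) }

/-- By the chain rule the velocity is X_H + DΦ·X_G, and naturality identifies the second term with
the field of G∘Φ⁻¹. -/
theorem mul {Ψ : ℝ → (ℂ ≃ₜ ℂ)} {G : ℝ → ℂ → ℝ} (h : SmoothIso K Φ H) (h' : SmoothIso K Ψ G) :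
    SmoothIso K (fun t => Φ t * Ψ t) (fun t z => H t z + G t ((Φ t).symm z)) where
  ham := h.ham.add (h'.ham.comp (contDiff_fst.prodMk h.bwd))
  supp t z hz := by rw [h.symm_eq t hz, h.supp t z hz, h'.supp t z hz, add_zero]
  fwd := h.fwd.comp (contDiff_fst.prodMk h'.fwd)
  bwd := h'.bwd.comp (contDiff_fst.prodMk h.bwd)
  zero z := by simp [h.zero, h'.zero]
  deriv t z := by
    refine (h.hasDerivAt_comp (h'.deriv t z)).congr_deriv ?_
    have hG : DifferentiableAt ℝ (fun w => G t ((Φ t).symm w)) (Φ t (Ψ t z)) :=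
      ((h'.ham_slice t).comp (h.bwd_slice t)).differentiable (by simp) _
    change _ = hamField _ (Φ t (Ψ t z))
    rw [hamField_add (h.ham_diff t _) hG, ← h.hamField_pullback hG]
    simp

theorem inv (h : SmoothIso K Φ H) : SmoothIso K (fun t => (Φ t)⁻¹) (fun t z => -H t (Φ t z)) where
  ham := (h.ham.comp (contDiff_fst.prodMk h.fwd)).neg
  supp t z hz := by rw [h.eq_id t hz, h.supp t z hz, neg_zero]
  fwd := h.bwd
  bwd := h.fwd
  -- With K empty, the support condition says that Φ 0 fixes every point.
  zero z := symm_eq_of_eq_id (K := ∅) (fun z _ => h.zero z) (by simp)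
  deriv t z := h.hasDerivAt_symm t z

/-- The conformal factor c covers both uses: c = 1 for symplectic conjugators and c = 4 for the
dilation. -/
theorem conj {K' : IntCompact} (h : SmoothIso K Φ H) {c : ℝ} (hc : c ≠ 0) {ψ : ℂ ≃ₜ ℂ}
    (hψ : ContDiff ℝ ∞ ψ) (hψ' : ContDiff ℝ ∞ ψ.symm) (hK : ∀ z, z ∉ K'.1 → ψ z ∉ K.1)
    (hA : ∀ z u v, areaForm (fderiv ℝ ψ z u) (fderiv ℝ ψ z v) = c * areaForm u v) :
    SmoothIso K' (fun t => ψ⁻¹ * Φ t * ψ) (fun t z => c⁻¹ * H t (ψ z)) where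
  ham := contDiff_const.mul (h.ham.comp (contDiff_fst.prodMk (hψ.comp contDiff_snd)))
  supp t z hz := by rw [h.supp t _ (hK z hz), mul_zero]
  fwd := hψ'.comp (h.fwd.comp (contDiff_fst.prodMk (hψ.comp contDiff_snd)))
  bwd := hψ'.comp (h.bwd.comp (contDiff_fst.prodMk (hψ.comp contDiff_snd)))
  zero z := (congrArg ψ.symm (h.zero (ψ z))).trans (ψ.symm_apply_apply z)
  deriv t z := by
    have hd : DifferentiableAt ℝ ψ.symm (Φ t (ψ z)) := hψ'.differentiable (by simp) _
    refine (hd.hasFDerivAt.comp_hasDerivAt t (h.deriv t (ψ z))).congr_deriv ?_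
    change _ = hamField _ (ψ.symm (Φ t (ψ z)))
    set w := ψ.symm (Φ t (ψ z)) with hw
    have hwψ : Φ t (ψ z) = ψ w := by simp [hw]
    have hψw : DifferentiableAt ℝ ψ w := hψ.differentiable (by simp) _
    rw [hwψ] at hd ⊢
    rw [← hamField_comp hc hψw (h.ham_diff t (ψ w)) (hA w)]
    -- D(ψ⁻¹) is a left inverse of Dψ, so it cancels the Dψ produced by naturality.
    have hcomp := (hd.hasFDerivAt.comp w hψw.hasFDerivAt).congr_of_eventuallyEq
      (Eventually.of_forall fun x => (ψ.symm_apply_apply x).symm) (f₁ := fun x => x)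
    exact congrArg (fun M : ℂ →L[ℝ] ℂ => M (hamField (fun z => c⁻¹ * H t (ψ z)) w))
      (hcomp.unique (hasFDerivAt_id w))

end SmoothIso

theorem mem_smoothPairs_iff {K : IntCompact} {p : PathHam} :
    p ∈ smoothPairs K ↔ ∃ Φ H, SmoothIso K Φ H ∧
      (∀ t : unitInterval, p.path t = Φ t) ∧ ∀ t : unitInterval, p.ham t = H t := by
  constructor
  · rintro ⟨Φ, H, h1, h2, h3, h4, h5, h6, h7, h8⟩
    exact ⟨Φ, H, ⟨h1, h2, h3, h4, h5, h6⟩, h7, h8⟩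
  · rintro ⟨Φ, H, ⟨h1, h2, h3, h4, h5, h6⟩, h7, h8⟩
    exact ⟨Φ, H, h1, h2, h3, h4, h5, h6, h7, h8⟩

/-! ### Operations on smooth Hamiltonian pairs -/

section smoothPairs

variable {K K' : IntCompact} {p q : PathHam}

theorem smoothPairs_mono (hK : K.1 ⊆ K'.1) : smoothPairs K ⊆ smoothPairs K' := by
  intro p hp
  obtain ⟨Φ, H, h, h1, h2⟩ := mem_smoothPairs_iff.1 hp
  exact mem_smoothPairs_iff.2 ⟨Φ, H, h.mono hK, h1, h2⟩

theorem mul_mem_smoothPairs (hp : p ∈ smoothPairs K) (hq : q ∈ smoothPairs K) :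
    p.mul q ∈ smoothPairs K := by
  obtain ⟨Φ, H, h, h1, h2⟩ := mem_smoothPairs_iff.1 hp
  obtain ⟨Ψ, G, h', h1', h2'⟩ := mem_smoothPairs_iff.1 hq
  exact mem_smoothPairs_iff.2 ⟨_, _, h.mul h', fun t => by simp [PathHam.mul, h1, h1'],
    fun t => by funext z; simp [PathHam.mul, h1, h2, h2']⟩

theorem inv_mem_smoothPairs (hp : p ∈ smoothPairs K) : p.inv ∈ smoothPairs K := by
  obtain ⟨Φ, H, h, h1, h2⟩ := mem_smoothPairs_iff.1 hp
  exact mem_smoothPairs_iff.2 ⟨_, _, h.inv, fun t => by simp [PathHam.inv, h1],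
    fun t => by funext z; simp [PathHam.inv, h1, h2]⟩

theorem conj_mem_smoothPairs (hp : p ∈ smoothPairs K) {c : ℝ} (hc : c ≠ 0) {ψ : ℂ ≃ₜ ℂ}
    (hψ : ContDiff ℝ ∞ ψ) (hψ' : ContDiff ℝ ∞ ψ.symm) (hK : ∀ z, z ∉ K'.1 → ψ z ∉ K.1)
    (hA : ∀ z u v, areaForm (fderiv ℝ ψ z u) (fderiv ℝ ψ z v) = c * areaForm u v) :
    p.conj c ψ ∈ smoothPairs K' := by
  obtain ⟨Φ, H, h, h1, h2⟩ := mem_smoothPairs_iff.1 hp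
  exact mem_smoothPairs_iff.2 ⟨_, _, h.conj hc hψ hψ' hK hA, fun t => by simp [PathHam.conj, h1],
    fun t => by funext z; simp [PathHam.conj, h2]⟩

theorem path_mem_symp (hp : p ∈ smoothPairs K) (t : unitInterval) : p.path t ∈ symp K := by
  obtain ⟨Φ, H, h, h1, h2⟩ := mem_smoothPairs_iff.1 hp
  rw [h1]
  exact h.mem_symp t

theorem unif_of_mem_smoothPairs (hp : p ∈ smoothPairs K) : p.Unif := by
  obtain ⟨Φ, H, h, h1, h2⟩ := mem_smoothPairs_iff.1 hp
  have hc : Continuous fun q : unitInterval × ℂ => ((q.1 : ℝ), q.2) := by fun_prop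
  have e1 : p.fwd = fun q => Φ q.1 q.2 := by funext q; simp [PathHam.fwd, h1]
  have e2 : p.bwd = fun q => (Φ q.1).symm q.2 := by funext q; simp [PathHam.bwd, h1]
  have e3 : p.fn = fun q => H q.1 q.2 := by funext q; simp [PathHam.fn, h2]
  refine ⟨?_, ?_, ?_⟩
  · rw [e1]
    exact uniformContinuous_of_eq_id K.2.1 (h.fwd.continuous.comp hc) fun t z hz => h.eq_id t hz
  · rw [e2]
    exact uniformContinuous_of_eq_id K.2.1 (h.bwd.continuous.comp hc) fun t z hz => h.symm_eq t hz
  · rw [e3]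
    exact uniformContinuous_of_vanish K.2.1 (h.ham.continuous.comp hc) fun t z hz => h.supp t z hz

end smoothPairs

/-! ### The groups of symplectic and of Hamiltonian homeomorphisms -/

/-- The union of two compact subsets of the open disc. -/
def IntCompact.union (K K' : IntCompact) : IntCompact :=
  ⟨K.1 ∪ K'.1, K.2.1.union K'.2.1, union_subset K.2.2 K'.2.2⟩

/-- The empty compact subset of the open disc. -/
def IntCompact.empty : IntCompact := ⟨∅, isCompact_empty, empty_subset _⟩

theorem symp_mono {K K' : IntCompact} (h : K.1 ⊆ K'.1) : symp K ⊆ symp K' :=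
  fun _ hφ => ⟨hφ.1, hφ.2.1, fun z hz => hφ.2.2.1 z fun hm => hz (h hm), hφ.2.2.2⟩

theorem homeoUnif_of_mem_symp {K : IntCompact} {φ : ℂ ≃ₜ ℂ} (hφ : φ ∈ symp K) : HomeoUnif φ :=
  .of_eq_id K.2.1 hφ.2.2.1

theorem one_mem_symp (K : IntCompact) : (1 : ℂ ≃ₜ ℂ) ∈ symp K := by
  refine ⟨contDiff_id, contDiff_id, fun z _ => rfl, fun z u v => ?_⟩
  change areaForm (fderiv ℝ id z u) (fderiv ℝ id z v) = _
  simp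

theorem mul_mem_symp {K : IntCompact} {φ ψ : ℂ ≃ₜ ℂ} (hφ : φ ∈ symp K) (hψ : ψ ∈ symp K) :
    φ * ψ ∈ symp K := by
  refine ⟨hφ.1.comp hψ.1, hψ.2.1.comp hφ.2.1, fun z hz => ?_, fun z u v => ?_⟩
  · rw [Homeomorph.mul_apply, hψ.2.2.1 z hz, hφ.2.2.1 z hz]
  · have h := fderiv_comp z (hφ.1.differentiable (by simp) (ψ z)) (hψ.1.differentiable (by simp) z)
    have h' : fderiv ℝ (φ * ψ) z = (fderiv ℝ φ (ψ z)).comp (fderiv ℝ ψ z) := h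
    rw [h', ContinuousLinearMap.comp_apply, ContinuousLinearMap.comp_apply, hφ.2.2.2, hψ.2.2.2]

theorem inv_mem_symp {K : IntCompact} {φ : ℂ ≃ₜ ℂ} (hφ : φ ∈ symp K) : φ⁻¹ ∈ symp K := by
  refine ⟨hφ.2.1, hφ.1, fun z hz => symm_eq_of_eq_id hφ.2.2.1 hz, fun z u v => ?_⟩
  have h := fderiv_comp z (hφ.1.differentiable (by simp) (φ.symm z))
    (hφ.2.1.differentiable (by simp) z)
  have h' : φ ∘ φ.symm = id := funext φ.apply_symm_apply
  rw [h', fderiv_id] at h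
  have hu : ∀ u, fderiv ℝ φ (φ.symm z) (fderiv ℝ φ.symm z u) = u :=
    fun u => (congrArg (fun M : ℂ →L[ℝ] ℂ => M u) h).symm
  change areaForm (fderiv ℝ φ.symm z u) (fderiv ℝ φ.symm z v) = _
  rw [← hφ.2.2.2 (φ.symm z), hu, hu]

theorem exists_filter_of_mem_sympeo {φ : ℂ ≃ₜ ℂ} (h : φ ∈ sympeo) :
    ∃ (K : IntCompact) (l : Filter (ℂ ≃ₜ ℂ)), l.NeBot ∧ symp K ∈ l ∧
      HomeoTendsto (fun ψ => ψ) l φ ∧ HomeoUnif φ := by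
  obtain ⟨K, hK⟩ := h
  obtain ⟨l, h1, h2, h3⟩ := exists_filter_of_mem_closure_image hK
  have h4 := tendsto_homeoGraph_iff.1 h3
  exact ⟨K, l, h1, h2, h4, .of_tendsto h4 (mem_of_superset h2 fun _ => homeoUnif_of_mem_symp)⟩

theorem HomeoTendsto.mem_sympeo {ι : Type*} {F : ι → (ℂ ≃ₜ ℂ)} {l : Filter ι} [l.NeBot]
    {φ : ℂ ≃ₜ ℂ} (h : HomeoTendsto F l φ) {K : IntCompact} (hF : ∀ᶠ i in l, F i ∈ symp K) :
    φ ∈ sympeo :=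
  ⟨K, mem_closure_image_of_tendsto hF (tendsto_homeoGraph_iff.2 h)⟩

theorem one_mem_sympeo : (1 : ℂ ≃ₜ ℂ) ∈ sympeo :=
  ⟨.empty, subset_closure (mem_image_of_mem _ (one_mem_symp _))⟩

/-- The two approximations are run independently along the product filter, with supports in the
union of the two compact sets. -/
theorem mul_mem_sympeo {φ ψ : ℂ ≃ₜ ℂ} (hφ : φ ∈ sympeo) (hψ : ψ ∈ sympeo) : φ * ψ ∈ sympeo := by
  obtain ⟨K, l, _, h1, h2, h3⟩ := exists_filter_of_mem_sympeo hφ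
  obtain ⟨K', l', _, h1', h2', h3'⟩ := exists_filter_of_mem_sympeo hψ
  refine ((h2.comp (tendsto_fst (g := l'))).mul (h2'.comp tendsto_snd) h3 h3').mem_sympeo
    (K := K.union K') ?_
  filter_upwards [prod_mem_prod h1 h1'] with i hi
  exact mul_mem_symp (symp_mono subset_union_left hi.1) (symp_mono subset_union_right hi.2)

theorem inv_mem_sympeo {φ : ℂ ≃ₜ ℂ} (hφ : φ ∈ sympeo) : φ⁻¹ ∈ sympeo := by
  obtain ⟨K, l, _, h1, h2, h3⟩ := exists_filter_of_mem_sympeo hφ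
  exact h2.inv.mem_sympeo (mem_of_superset h1 fun _ => inv_mem_symp)

/-- The group `Sympeo(D², ∂D²)`. -/
def sympeoGroup : Subgroup (ℂ ≃ₜ ℂ) where
  carrier := sympeo
  one_mem' := one_mem_sympeo
  mul_mem' := mul_mem_sympeo
  inv_mem' := inv_mem_sympeo

/-! ### Hamiltonian homeomorphisms: group structure and normality -/

theorem exists_filter_of_mem_contPairs {K : IntCompact} {p : PathHam} (h : p ∈ contPairs K) :
    ∃ l : Filter PathHam, l.NeBot ∧ smoothPairs K ∈ l ∧ p.Unif ∧
      PathHam.Tends (fun q => q) l p := by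
  obtain ⟨l, h1, h2, h3⟩ := PathHam.mem_closure_iff_exists_filter h
  exact ⟨l, h1, h2, .of_tends h3 (mem_of_superset h2 fun _ => unif_of_mem_smoothPairs), h3⟩

theorem one_mem_hameo : (1 : ℂ ≃ₜ ℂ) ∈ hameo := by
  refine ⟨.empty, ⟨fun _ => 1, fun _ _ => 0⟩, subset_closure (mem_smoothPairs_iff.2
    ⟨fun _ => 1, fun _ _ => 0, ⟨contDiff_const, fun _ _ _ => rfl, contDiff_snd, contDiff_snd,
      fun _ => rfl, fun t z => ?_⟩, fun _ => rfl, fun _ => rfl⟩), rfl⟩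
  have : hamField (fun _ => (0 : ℝ)) z = 0 := hamField_eq_zero isClosed_empty (by simp) (by simp)
  exact (hasDerivAt_const t z).congr_deriv this.symm

theorem mul_mem_hameo {φ ψ : ℂ ≃ₜ ℂ} (hφ : φ ∈ hameo) (hψ : ψ ∈ hameo) : φ * ψ ∈ hameo := by
  obtain ⟨K, p, hp, rfl⟩ := hφ
  obtain ⟨K', q, hq, rfl⟩ := hψ
  obtain ⟨l, _, h1, h2, h3⟩ := exists_filter_of_mem_contPairs hp
  obtain ⟨l', _, h1', h2', h3'⟩ := exists_filter_of_mem_contPairs hq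
  refine ⟨K.union K', p.mul q, ((h3.comp (tendsto_fst (g := l'))).mul
    (h3'.comp tendsto_snd) h2 h2').mem_closure ?_, rfl⟩
  filter_upwards [prod_mem_prod h1 h1'] with i hi
  exact mul_mem_smoothPairs (smoothPairs_mono subset_union_left hi.1)
    (smoothPairs_mono subset_union_right hi.2)

theorem inv_mem_hameo {φ : ℂ ≃ₜ ℂ} (hφ : φ ∈ hameo) : φ⁻¹ ∈ hameo := by
  obtain ⟨K, p, hp, rfl⟩ := hφ
  obtain ⟨l, _, h1, h2, h3⟩ := exists_filter_of_mem_contPairs hp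
  exact ⟨K, p.inv, (h3.inv h2).mem_closure (mem_of_superset h1 fun _ => inv_mem_smoothPairs), rfl⟩

/-- The group `Hameo(D², ∂D²)`. -/
def hameoGroup : Subgroup (ℂ ≃ₜ ℂ) where
  carrier := hameo
  one_mem' := one_mem_hameo
  mul_mem' := mul_mem_hameo
  inv_mem' := inv_mem_hameo

theorem hameo_subset_sympeo : hameo ⊆ sympeo := by
  rintro _ ⟨K, p, hp, rfl⟩
  obtain ⟨l, _, h1, -, h3⟩ := exists_filter_of_mem_contPairs hp
  exact (h3.eval 1).mem_sympeo (mem_of_superset h1 fun _ hq => path_mem_symp hq 1)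

/-- The conjugated Hamiltonian is H∘ψ, which involves no derivative of ψ; hence C⁰ convergence of
the conjugators is enough for convergence in the Hamiltonian topology. -/
theorem conj_mem_hameo {φ ψ : ℂ ≃ₜ ℂ} (hφ : φ ∈ hameo) (hψ : ψ ∈ sympeo) :
    ψ⁻¹ * φ * ψ ∈ hameo := by
  obtain ⟨K, p, hp, rfl⟩ := hφ
  obtain ⟨l, _, h1, h2, h3⟩ := exists_filter_of_mem_contPairs hp
  obtain ⟨K', l', _, h1', h2', h3'⟩ := exists_filter_of_mem_sympeo hψ
  refine ⟨K.union K', p.conj 1 ψ, ((h3.comp (tendsto_fst (g := l'))).conj 1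
    (h2'.comp tendsto_snd) h2 h3').mem_closure ?_, rfl⟩
  filter_upwards [prod_mem_prod h1 h1'] with i hi
  have hs : i.2 ∈ symp K' := hi.2
  refine conj_mem_smoothPairs hi.1 one_ne_zero hs.1 hs.2.1 (fun z hz hm => ?_)
    fun z u v => by rw [hs.2.2.2, one_mul]
  rw [hs.2.2.1 z fun h => hz (Or.inr h)] at hm
  exact hz (Or.inl hm)

theorem hameoGroup_normal : (hameoGroup.subgroupOf sympeoGroup).Normal where
  conj_mem n hn g := by
    have h := conj_mem_hameo (φ := n) (ψ := (g⁻¹ : sympeoGroup)) hn (g⁻¹).2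
    have h' : ((g * n * g⁻¹ : sympeoGroup) : ℂ ≃ₜ ℂ) ∈ hameoGroup := by
      simpa using (show _ ∈ hameoGroup from h)
    exact h'

/-! ### Twists as smooth Hamiltonian isotopies -/

/-- The norm is not smooth at the origin, but `g` is constant near there. -/
theorem contDiff_radial {g : ℝ → ℝ} (hg : ContDiff ℝ ∞ g) {a c : ℝ} (ha : 0 < a)
    (h : ∀ r ≤ a, g r = c) : ContDiff ℝ ∞ fun z : ℂ => g ‖z‖ := by
  rw [contDiff_iff_contDiffAt]
  intro z
  by_cases hz : z = 0
  · refine (contDiffAt_const (c := c)).congr_of_eventuallyEq ?_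
    have : Metric.ball (0 : ℂ) a ∈ 𝓝 z := Metric.isOpen_ball.mem_nhds (by simpa [hz])
    filter_upwards [this] with w hw
    exact h _ (mem_ball_zero_iff.1 hw).le
  · exact hg.contDiffAt.comp z (contDiffAt_norm ℝ hz)

/-- The potential `r ↦ -∫₁^r s σ(s) ds` of a twist profile. -/
noncomputable def twistPot (σ : ℝ → ℝ) (r : ℝ) : ℝ := -∫ s in (1 : ℝ)..r, s * σ s

theorem hasDerivAt_twistPot {σ : ℝ → ℝ} (hσ : Continuous σ) (r : ℝ) :
    HasDerivAt (twistPot σ) (-(r * σ r)) r :=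
  ((continuous_id.mul hσ).integral_hasStrictDerivAt 1 r).hasDerivAt.neg

theorem contDiff_twistPot {σ : ℝ → ℝ} (hσ : ContDiff ℝ ∞ σ) : ContDiff ℝ ∞ (twistPot σ) := by
  rw [contDiff_infty_iff_deriv]
  refine ⟨fun r => (hasDerivAt_twistPot hσ.continuous r).differentiableAt, ?_⟩
  have : deriv (twistPot σ) = fun r => -(r * σ r) :=
    funext fun r => (hasDerivAt_twistPot hσ.continuous r).deriv
  rw [this]
  exact (contDiff_id.mul hσ).neg

theorem twistPot_eq {σ : ℝ → ℝ} (hσ : Continuous σ) {a : ℝ} (h : ∀ r ≤ a, σ r = 0) {r : ℝ}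
    (hr : r ≤ a) : twistPot σ r = twistPot σ a := by
  have hi : ∀ x y, IntervalIntegrable (fun s => s * σ s) MeasureTheory.volume x y :=
    fun x y => (continuous_id.mul hσ).intervalIntegrable x y
  have h0 : ∫ s in r..a, s * σ s = 0 := by
    refine (intervalIntegral.integral_congr (g := fun _ => 0) fun s hs => ?_).trans (by simp)
    rw [uIcc_of_le hr] at hs
    simp [h s hs.2]
  simp only [twistPot]
  rw [← intervalIntegral.integral_add_adjacent_intervals (hi 1 r) (hi r a), h0, add_zero]

theorem twistPot_eq_zero {σ : ℝ → ℝ} {b : ℝ} (hb : b < 1) (h : ∀ r, b ≤ r → σ r = 0) {r : ℝ}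
    (hr : b ≤ r) : twistPot σ r = 0 := by
  rw [twistPot, neg_eq_zero]
  refine (intervalIntegral.integral_congr (g := fun _ => 0) fun s hs => ?_).trans (by simp)
  have : b ≤ s := (le_min hb.le hr).trans hs.1
  simp [h s this]

/-- Closed concentric discs inside the open unit disc. -/
def IntCompact.disc (b : ℝ) (hb : b < 1) : IntCompact :=
  ⟨Metric.closedBall 0 b, isCompact_closedBall 0 b, Metric.closedBall_subset_ball hb⟩

/-- Smooth profiles which vanish near `0` and near `1`. -/
structure TwistProfile (σ : ℝ → ℝ) (a b : ℝ) : Prop where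
  smooth : ContDiff ℝ ∞ σ
  pos : 0 < a
  lt_one : b < 1
  inner : ∀ r ≤ a, σ r = 0
  outer : ∀ r, b ≤ r → σ r = 0

namespace TwistProfile

variable {σ : ℝ → ℝ} {a b : ℝ}

theorem contDiff_twistHam (h : TwistProfile σ a b) : ContDiff ℝ ∞ (twistHam σ) :=
  contDiff_radial (contDiff_twistPot h.smooth) h.pos
    fun _ hr => twistPot_eq h.smooth.continuous h.inner hr

theorem twistHam_eq_zero (h : TwistProfile σ a b) {z : ℂ} (hz : b ≤ ‖z‖) : twistHam σ z = 0 :=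
  twistPot_eq_zero h.lt_one h.outer hz

/-- The potential has radial derivative -rσ(r), so its Hamiltonian field rotates the circle of
radius r with angular speed σ(r). -/
theorem hamField_twistHam (h : TwistProfile σ a b) (z : ℂ) :
    hamField (twistHam σ) z = z * (σ ‖z‖ * Complex.I) := by
  by_cases hz : z = 0
  · have h1 : twistHam σ =ᶠ[𝓝 z] fun _ => twistPot σ a := by
      have : Metric.ball (0 : ℂ) a ∈ 𝓝 z := Metric.isOpen_ball.mem_nhds (by simpa [hz] using h.pos)
      filter_upwards [this] with w hw
      exact twistPot_eq h.smooth.continuous h.inner (mem_ball_zero_iff.1 hw).le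
    have h2 : fderiv ℝ (twistHam σ) z = 0 := by rw [h1.fderiv_eq]; simp
    rw [hamField, h2, hz]
    apply Complex.ext <;> simp
  · have hn : ‖z‖ ≠ 0 := norm_ne_zero_iff.2 hz
    have h1 : HasFDerivAt (fun w : ℂ => ‖w‖ ^ 2) (2 • innerSL ℝ z) z :=
      (hasStrictFDerivAt_norm_sq z).hasFDerivAt
    have h2 := h1.sqrt (pow_ne_zero 2 hn)
    simp only [Real.sqrt_sq (norm_nonneg _)] at h2
    have h3 := ((hasDerivAt_twistPot h.smooth.continuous ‖z‖).comp_hasFDerivAt z h2).fderiv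
    have h4 : fderiv ℝ (twistHam σ) z = _ := h3
    apply Complex.ext
    · simp [hamField, h4]
      field_simp
    · simp [hamField, h4]
      field_simp

theorem continuousOn_mul (h : TwistProfile σ a b) (t : ℝ) :
    ContinuousOn (fun r => t * σ r) (Ioi 0) :=
  (h.smooth.continuous.const_mul t).continuousOn

theorem contDiff_twistFun (h : TwistProfile σ a b) :
    ContDiff ℝ ∞ fun q : ℝ × ℂ => twistFun (fun r => q.1 * σ r) q.2 := by
  have h1 : ContDiff ℝ ∞ fun q : ℝ × ℂ => q.1 * σ ‖q.2‖ :=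
    contDiff_fst.mul ((contDiff_radial h.smooth h.pos h.inner).comp contDiff_snd)
  exact contDiff_snd.mul ((Complex.ofRealCLM.contDiff.comp h1).mul contDiff_const).cexp

/-- The flow preserves the norm, so the angular speed is constant along orbits and the time-t map is
the twist by tσ. -/
theorem smoothIso (h : TwistProfile σ a b) : SmoothIso (.disc b h.lt_one)
    (fun t => twist (fun r => t * σ r) (h.continuousOn_mul t)) (fun _ => twistHam σ) where
  ham := h.contDiff_twistHam.comp contDiff_snd
  supp t z hz := by
    refine h.twistHam_eq_zero ?_
    by_contra hlt
    exact hz (mem_closedBall_zero_iff.2 (not_le.1 hlt).le)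
  fwd := h.contDiff_twistFun
  bwd := by
    have h1 := h.contDiff_twistFun.comp
      (contDiff_fst.neg.prodMk contDiff_snd : ContDiff ℝ ∞ fun q : ℝ × ℂ => (-q.1, q.2))
    have h2 : (fun q : ℝ × ℂ => (twist (fun r => q.1 * σ r) (h.continuousOn_mul q.1)).symm q.2) =
        (fun q : ℝ × ℂ => twistFun (fun r => q.1 * σ r) q.2) ∘ fun q : ℝ × ℂ => (-q.1, q.2) := by
      funext q
      change twistFun (-fun r => q.1 * σ r) q.2 = twistFun (fun r => -q.1 * σ r) q.2
      congr 1
      funext r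
      simp
    rwa [h2]
  zero z := by simp [twist, twistFun]
  deriv t z := by
    rw [h.hamField_twistHam]
    change HasDerivAt (fun s : ℝ => z * Complex.exp (((s * σ ‖z‖ : ℝ) : ℂ) * Complex.I))
      (twistFun (fun r => t * σ r) z * (σ ‖twistFun (fun r => t * σ r) z‖ * Complex.I)) t
    rw [norm_twistFun]
    have h1 : HasDerivAt (fun s : ℝ => ((s * σ ‖z‖ : ℝ) : ℂ) * Complex.I)
        (σ ‖z‖ * Complex.I) t := by
      have := ((hasDerivAt_id t).mul_const (σ ‖z‖)).ofReal_comp.mul_const Complex.I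
      simpa using this
    refine (h1.cexp.const_mul z).congr_deriv ?_
    simp only [twistFun]
    ring

/-- The twist isotopy paired with its Hamiltonian. -/
noncomputable def pair (h : TwistProfile σ a b) : PathHam where
  path t := twist (fun r => t * σ r) (h.continuousOn_mul t)
  ham _ := twistHam σ

theorem pair_mem (h : TwistProfile σ a b) : h.pair ∈ smoothPairs (.disc b h.lt_one) :=
  mem_smoothPairs_iff.2 ⟨_, _, h.smoothIso, fun _ => rfl, fun _ => rfl⟩

theorem pair_path_one (h : TwistProfile σ a b) :
    h.pair.path 1 = twist σ h.smooth.continuous.continuousOn := by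
  ext z
  simp [pair, twist]

end TwistProfile

/-- A crude bound, but independent of the profiles: it controls the infinite twist near 0, where no
bound on ρ is available. -/
theorem dist_twistFun_le (σ τ : ℝ → ℝ) (z : ℂ) : dist (twistFun σ z) (twistFun τ z) ≤ 2 * ‖z‖ := by
  rw [dist_eq_norm]
  refine (norm_sub_le _ _).trans ?_
  rw [norm_twistFun, norm_twistFun, two_mul]

theorem twist_pow_apply {σ : ℝ → ℝ} (hσ : ContinuousOn σ (Ioi 0)) (n : ℕ) (z : ℂ) :
    (twist σ hσ ^ n) z = twistFun (fun r => n * σ r) z := by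
  induction n with
  | zero => simp [twistFun]
  | succ n ih =>
    rw [pow_succ', Homeomorph.mul_apply, ih]
    change twistFun σ _ = _
    rw [twistFun, norm_twistFun, twistFun, twistFun, mul_assoc, ← Complex.exp_add]
    push_cast
    ring_nf

/-! ### Dyadic profiles -/

namespace DyadicProfile

variable {ρ : ℕ → ℝ → ℝ}

/-- The support of `ρ 0` is compact in an open interval, hence stays away from 1. One disc then
contains the supports of all truncations. -/
theorem exists_outer (h : DyadicProfile ρ) : ∃ b < 1, ∀ j r, b ≤ r → ρ j r = 0 := by
  have hc : IsCompact (tsupport (ρ 0)) :=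
    isCompact_Icc.of_isClosed_subset (isClosed_tsupport _) ((h.supp 0).trans Ioo_subset_Icc_self)
  -- Adjoining 1/2 makes the compact set nonempty and forces m ≥ 1/2, beyond the supports of all
  -- later pieces.
  obtain ⟨m, hm, hmax⟩ := (hc.insert (1 / 2)).exists_isGreatest ⟨1 / 2, mem_insert _ _⟩
  have hm1 : m < 1 := by
    rcases hm with rfl | hm
    · norm_num
    · simpa using (h.supp 0 hm).2
  have hm2 : 1 / 2 ≤ m := hmax (mem_insert _ _)
  refine ⟨(m + 1) / 2, by linarith, fun j r hr => ?_⟩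
  cases j with
  | zero =>
    refine image_eq_zero_of_notMem_tsupport fun hmem => ?_
    have := hmax (mem_insert_of_mem _ hmem)
    linarith
  | succ j =>
    refine h.eq_zero fun hmem => ?_
    have : (1 / 2 : ℝ) ^ (j + 1) ≤ (1 / 2) ^ 1 :=
      pow_le_pow_of_le_one (by norm_num) (by norm_num) (by omega)
    have := hmem.2
    linarith

theorem inner (h : DyadicProfile ρ) {j n : ℕ} (hjn : j < n) {r : ℝ} (hr : r ≤ (1 / 2) ^ n) :
    ρ j r = 0 := by
  refine h.eq_zero fun hm => ?_
  have : (1 / 2 : ℝ) ^ n ≤ (1 / 2) ^ (j + 1) :=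
    pow_le_pow_of_le_one (by norm_num) (by norm_num) hjn
  linarith [hm.1]

/-- The finite truncations of the total profile. -/
theorem twistProfile_sum (h : DyadicProfile ρ) {b : ℝ} (hb : b < 1)
    (hout : ∀ j r, b ≤ r → ρ j r = 0) (n : ℕ) :
    TwistProfile (fun r => ∑ j ∈ Finset.range n, ρ j r) ((1 / 2) ^ n) b where
  smooth := ContDiff.sum fun j _ => h.smooth j
  pos := by positivity
  lt_one := hb
  inner _ hr := Finset.sum_eq_zero fun _ hj => h.inner (Finset.mem_range.1 hj) hr
  outer r hr := Finset.sum_eq_zero fun j _ => hout j r hr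

theorem twistProfile_zero (h : DyadicProfile ρ) {b : ℝ} (hb : b < 1)
    (hout : ∀ j r, b ≤ r → ρ j r = 0) : TwistProfile (ρ 0) ((1 / 2) ^ 1) b where
  smooth := h.smooth 0
  pos := by positivity
  lt_one := hb
  inner _ hr := h.inner zero_lt_one hr
  outer r hr := hout 0 r hr

theorem totalProfile_eq_sum (h : DyadicProfile ρ) {n : ℕ} {r : ℝ} (hr : (1 / 2) ^ n ≤ r) :
    totalProfile ρ r = ∑ j ∈ Finset.range n, ρ j r := by
  refine finsum_eq_sum_of_support_subset _ fun j hj => ?_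
  simp only [Finset.coe_range, mem_Iio]
  by_contra hjn
  refine hj (h.eq_zero fun hm => ?_)
  have : (1 / 2 : ℝ) ^ j ≤ (1 / 2 : ℝ) ^ n :=
    pow_le_pow_of_le_one (by norm_num) (by norm_num) (not_lt.1 hjn)
  linarith [hm.2]

/-- Off the dyadic interval both sides vanish, so the scaling rule holds for every real r. -/
theorem succ_eq (h : DyadicProfile ρ) (j : ℕ) (r : ℝ) : ρ (j + 1) r = 2 ^ 4 * ρ j (2 * r) := by
  by_cases hr : r ∈ Ioo ((1 / 2 : ℝ) ^ (j + 2)) ((1 / 2 : ℝ) ^ (j + 1))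
  · exact h.scaling j r hr
  · rw [h.eq_zero hr, h.eq_zero, mul_zero]
    rintro ⟨h1, h2⟩
    refine hr ⟨?_, ?_⟩
    · rw [pow_succ]; linarith
    · rw [pow_succ]; linarith

theorem totalProfile_self_similar (h : DyadicProfile ρ) {r : ℝ} (hr : 0 < r) :
    totalProfile ρ r = ρ 0 r + 2 ^ 4 * totalProfile ρ (2 * r) := by
  obtain ⟨n, hn⟩ := exists_pow_lt_of_lt_one hr (by norm_num : (1 / 2 : ℝ) < 1)
  -- Doubling the radius shifts the cutoff by one index: n + 1 terms at r match n terms at 2r, and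
  -- the extra term is `ρ 0 r`.
  rw [h.totalProfile_eq_sum (n := n + 1) (by rw [pow_succ]; linarith),
    h.totalProfile_eq_sum (n := n) (r := 2 * r) (by linarith), Finset.sum_range_succ', add_comm,
    Finset.mul_sum]
  simp only [h.succ_eq]

/-- The infinite twist is a `C⁰`-limit of symplectic diffeomorphisms. -/
theorem infTwist_mem_sympeo (h : DyadicProfile ρ) : infTwist h ∈ sympeo := by
  obtain ⟨b, hb, hout⟩ := h.exists_outer
  have hP := h.twistProfile_sum hb hout
  have hlim : Tendsto (fun n : ℕ => 2 * (1 / 2 : ℝ) ^ n) atTop (𝓝 0) := by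
    simpa using (tendsto_pow_atTop_nhds_zero_of_lt_one (by norm_num : (0 : ℝ) ≤ 1 / 2)
      (by norm_num)).const_mul 2
  -- Taking `g` to be the identity or negation treats the twists and their inverses at once.
  have key : ∀ (g : (ℝ → ℝ) → ℝ → ℝ), (∀ σ τ r, σ r = τ r → g σ r = g τ r) →
      TendstoUniformly (fun n => twistFun (g fun r => ∑ j ∈ Finset.range n, ρ j r))
        (twistFun (g (totalProfile ρ))) atTop := by
    intro g hg
    rw [Metric.tendstoUniformly_iff]
    intro ε hε
    filter_upwards [hlim.eventually (gt_mem_nhds hε)] with n hn z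
    rcases le_total ((1 / 2 : ℝ) ^ n) ‖z‖ with hz | hz
    · have : twistFun (g (totalProfile ρ)) z
          = twistFun (g fun r => ∑ j ∈ Finset.range n, ρ j r) z := by
        rw [twistFun, twistFun,
          hg _ (fun r => ∑ j ∈ Finset.range n, ρ j r) _ (h.totalProfile_eq_sum hz)]
      rwa [this, dist_self]
    · refine (dist_twistFun_le _ _ z).trans_lt (lt_of_le_of_lt ?_ hn)
      linarith
  have hT : HomeoTendsto (fun n => twist _ (hP n).smooth.continuous.continuousOn) atTop
      (infTwist h) :=
    ⟨key id fun _ _ _ h => h, key Neg.neg fun _ _ _ h => congrArg Neg.neg h⟩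
  refine hT.mem_sympeo (K := .disc b hb) (Eventually.of_forall fun n => ?_)
  rw [← (hP n).pair_path_one]
  exact path_mem_symp (hP n).pair_mem 1

end DyadicProfile

/-- Dyadic profiles exist. -/
theorem exists_dyadicProfile : ∃ ρ, DyadicProfile ρ := by
  -- A bump supported in [5/8, 7/8], well inside (1/2, 1).
  let B : ContDiffBump (3 / 4 : ℝ) := ⟨1 / 16, 1 / 8, by norm_num, by norm_num⟩
  have hBs : tsupport B ⊆ Ioo (1 / 2) 1 := by
    rw [B.tsupport_eq, Real.closedBall_eq_Icc]
    exact Icc_subset_Ioo (by norm_num [B]) (by norm_num [B])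
  have hB0 : ∀ r, r ∉ Ioo (5 / 8 : ℝ) (7 / 8) → B r = 0 := by
    intro r hr
    refine B.zero_of_le_dist ?_
    by_contra hlt
    rw [Real.dist_eq, not_le, abs_lt] at hlt
    norm_num [B] at hlt
    exact hr ⟨by linarith, by linarith⟩
  have hBP : TwistProfile B (1 / 2) (7 / 8) :=
    ⟨B.contDiff, by norm_num, by norm_num, fun r hr => hB0 r fun hm => by linarith [hm.1],
      fun r hr => hB0 r fun hm => by linarith [hm.2]⟩
  have hnonneg : ∀ z, 0 ≤ twistHam B z := by
    intro z
    rcases le_total ‖z‖ 1 with hz | hz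
    · rw [twistHam, ← intervalIntegral.integral_symm]
      exact intervalIntegral.integral_nonneg hz fun s hs =>
        mul_nonneg ((norm_nonneg z).trans hs.1) B.nonneg
    · exact (hBP.twistHam_eq_zero (by linarith)).ge
  have hpos0 : 0 < twistHam B 0 := by
    rw [twistHam, ← intervalIntegral.integral_symm, norm_zero]
    refine intervalIntegral.integral_pos zero_lt_one
      (continuous_id.mul B.continuous).continuousOn (fun s hs => mul_nonneg hs.1.le B.nonneg)
      ⟨3 / 4, by constructor <;> norm_num, ?_⟩
    have : B (3 / 4) = 1 := B.one_of_mem_closedBall (by simp [B])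
    rw [this]
    norm_num
  have hsupp : ∀ z : ℂ, z ∉ Metric.closedBall (0 : ℂ) 1 → twistHam B z = 0 := by
    intro z hz
    rw [mem_closedBall_zero_iff, not_le] at hz
    exact hBP.twistHam_eq_zero (by linarith)
  have hint : 0 < ∫ z in Metric.closedBall (0 : ℂ) 1, twistHam B z := by
    rw [MeasureTheory.setIntegral_eq_integral_of_forall_compl_eq_zero hsupp]
    exact hBP.contDiff_twistHam.continuous.integral_pos_of_hasCompactSupport_nonneg_nonzero
      (HasCompactSupport.intro (isCompact_closedBall 0 1) hsupp) hnonneg hpos0.ne'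
  set I := ∫ z in Metric.closedBall (0 : ℂ) 1, twistHam B z with hI
  -- The potential is linear in the profile, so I⁻¹ normalises the first Calabi integral to 1; the
  -- factor 16 ^ j solves the scaling recursion.
  refine ⟨fun j r => I⁻¹ * 16 ^ j * B (2 ^ j * r), ?_, ?_, ?_, ?_, ?_⟩
  · exact fun j => contDiff_const.mul (B.contDiff.comp (contDiff_const.mul contDiff_id))
  · exact fun j r => mul_nonneg (by positivity) B.nonneg
  · intro j
    have h1 : tsupport (fun r => I⁻¹ * 16 ^ j * B (2 ^ j * r)) ⊆
        (fun r : ℝ => 2 ^ j * r) ⁻¹' tsupport B := by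
      refine closure_minimal (fun r hr => subset_tsupport _ ?_)
        ((isClosed_tsupport _).preimage (by fun_prop))
      exact right_ne_zero_of_mul hr
    refine h1.trans fun r hr => ?_
    have h2 := hBs hr
    have h3 : (0 : ℝ) < 2 ^ j := by positivity
    have h4 : (1 / 2 : ℝ) ^ j * 2 ^ j = 1 := by rw [← mul_pow]; norm_num
    constructor
    · rw [pow_succ]; nlinarith [h2.1]
    · nlinarith [h2.2]
  · intro j r _
    have : (2 : ℝ) ^ (j + 1) * r = 2 ^ j * (2 * r) := by ring
    change I⁻¹ * 16 ^ (j + 1) * B (2 ^ (j + 1) * r) = 2 ^ 4 * (I⁻¹ * 16 ^ j * B (2 ^ j * (2 * r)))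
    rw [this]
    ring
  · have : ∀ z, twistHam (fun r => I⁻¹ * 16 ^ 0 * B (2 ^ 0 * r)) z = I⁻¹ * twistHam B z := by
      intro z
      rw [twistHam, twistHam, mul_neg, ← intervalIntegral.integral_const_mul]
      congr 2
      funext s
      simp only [pow_zero, one_mul, mul_one]
      ring
    simp only [this]
    rw [MeasureTheory.integral_const_mul, inv_mul_cancel₀ hint.ne']

/-! ### Rescaling and the Calabi homomorphism -/

/-- The dilation `z ↦ 2z`. -/
noncomputable def dilation : ℂ ≃ₜ ℂ := Homeomorph.smulOfNeZero (2 : ℝ) two_ne_zero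

theorem dilation_apply (z : ℂ) : dilation z = (2 : ℝ) • z := rfl

theorem dilation_symm_apply (z : ℂ) : dilation.symm z = (2 : ℝ)⁻¹ • z := rfl

theorem contDiff_dilation : ContDiff ℝ ∞ dilation := contDiff_id.const_smul (2 : ℝ)

theorem contDiff_dilation_symm : ContDiff ℝ ∞ dilation.symm := contDiff_id.const_smul (2 : ℝ)⁻¹

theorem homeoUnif_dilation : HomeoUnif dilation :=
  ⟨uniformContinuous_const_smul (2 : ℝ), uniformContinuous_const_smul (2 : ℝ)⁻¹⟩

theorem areaForm_fderiv_dilation (z u v : ℂ) :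
    areaForm (fderiv ℝ dilation z u) (fderiv ℝ dilation z v) = 4 * areaForm u v := by
  have h : HasFDerivAt dilation ((2 : ℝ) • ContinuousLinearMap.id ℝ ℂ) z :=
    (hasFDerivAt_id z).const_smul (2 : ℝ)
  rw [h.fderiv]
  simp [areaForm]
  ring

/-- The preimage of a compact set under the dilation. -/
noncomputable def IntCompact.shrink (K : IntCompact) : IntCompact :=
  ⟨dilation ⁻¹' K.1, dilation.isCompact_preimage.2 K.2.1, fun z hz => by
    have h := mem_ball_zero_iff.1 (K.2.2 hz)
    rw [dilation_apply, norm_smul] at h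
    norm_num at h
    rw [mem_ball_zero_iff]
    linarith [norm_nonneg z]⟩

theorem conj_dilation_mem_smoothPairs {K : IntCompact} {p : PathHam} (hp : p ∈ smoothPairs K) :
    p.conj 4 dilation ∈ smoothPairs K.shrink :=
  conj_mem_smoothPairs hp (by norm_num) contDiff_dilation contDiff_dilation_symm
    (fun _ hz => hz) areaForm_fderiv_dilation

theorem conj_dilation_mem_contPairs {K : IntCompact} {p : PathHam} (hp : p ∈ contPairs K) :
    p.conj 4 dilation ∈ contPairs K.shrink := by
  obtain ⟨l, _, h1, h2, h3⟩ := exists_filter_of_mem_contPairs hp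
  exact (h3.conj 4 (G := fun _ => dilation) ⟨tendstoUniformly_const _, tendstoUniformly_const _⟩
    h2 homeoUnif_dilation).mem_closure (mem_of_superset h1 fun _ => conj_dilation_mem_smoothPairs)

/-- Both integrands vanish off the disc, so the integrals extend to the plane, where the dilation
has Jacobian 4. -/
theorem setIntegral_dilation {h : ℂ → ℝ} (hh : ∀ z, z ∉ Metric.ball (0 : ℂ) 1 → h z = 0) :
    ∫ z in Metric.closedBall (0 : ℂ) 1, h (dilation z) =
      4⁻¹ * ∫ z in Metric.closedBall (0 : ℂ) 1, h z := by
  rw [MeasureTheory.setIntegral_eq_integral_of_forall_compl_eq_zero,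
    MeasureTheory.setIntegral_eq_integral_of_forall_compl_eq_zero]
  · have := MeasureTheory.Measure.integral_comp_smul MeasureTheory.volume h (2 : ℝ)
    rw [Complex.finrank_real_complex] at this
    norm_num at this
    simpa [dilation_apply] using this
  · exact fun z hz => hh z fun hm => hz (Metric.ball_subset_closedBall hm)
  · intro z hz
    refine hh _ fun hm => hz ?_
    rw [dilation_apply, mem_ball_zero_iff, norm_smul] at hm
    norm_num at hm
    rw [mem_closedBall_zero_iff]
    linarith [norm_nonneg z]

/-- One factor 1/4 comes from the rescaled Hamiltonian, the other from the area. -/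
theorem calPath_conj_dilation {K : IntCompact} {p : PathHam} (hp : p ∈ smoothPairs K) :
    calPath (p.conj 4 dilation).ham = 16⁻¹ * calPath p.ham := by
  obtain ⟨Φ, H, h, -, h2⟩ := mem_smoothPairs_iff.1 hp
  rw [calPath, calPath, ← MeasureTheory.integral_const_mul]
  refine MeasureTheory.integral_congr_ae (Eventually.of_forall fun t => ?_)
  simp only [PathHam.conj]
  rw [MeasureTheory.integral_const_mul, setIntegral_dilation, ← mul_assoc]
  · norm_num
  · intro z hz
    rw [h2]
    exact h.supp t z fun hm => hz (K.2.2 hm)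

/-- An extended Calabi homomorphism scales by `1/16` under conjugation by the dilation: this holds
for smooth Hamiltonian paths, hence for their limits. -/
theorem calabi_conj_dilation {f : hameo → ℝ}
    (hf : ∀ K : IntCompact, ∀ p ∈ smoothPairs K, ∀ φ : hameo,
      (φ : ℂ ≃ₜ ℂ) = p.path 1 → f φ = calPath p.ham)
    (hc : @Continuous _ _ hamTopology _ f) {φ : ℂ ≃ₜ ℂ} (hφ : φ ∈ hameo) :
    ∃ hχ : dilation⁻¹ * φ * dilation ∈ hameo, f ⟨_, hχ⟩ = 16⁻¹ * f ⟨φ, hφ⟩ := by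
  have hev : ∀ K, Continuous fun p : contPairs K => f (ev1 K p) := fun K =>
    continuous_coinduced_dom.1 (continuous_iSup_dom.1 hc K)
  obtain ⟨K, p, hp, hpφ⟩ := hφ
  subst hpφ
  let S : contPairs K → contPairs K.shrink :=
    fun q => ⟨q.1.conj 4 dilation, conj_dilation_mem_contPairs q.2⟩
  have hS : Continuous S := by
    refine Continuous.subtype_mk (continuous_iff_continuousAt.2 fun q => ?_) _
    -- Only the uniform continuity `h2` of the limit pair is used here.
    obtain ⟨l, _, h1, h2, h3⟩ := exists_filter_of_mem_contPairs q.2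
    exact PathHam.tendsto_iff.2 ((PathHam.tendsto_iff.1 (continuous_subtype_val.tendsto q)).conj 4
      (G := fun _ => dilation) ⟨tendstoUniformly_const _, tendstoUniformly_const _⟩
      h2 homeoUnif_dilation)
  have hclosed : IsClosed {q : contPairs K | f (ev1 K.shrink (S q)) = 16⁻¹ * f (ev1 K q)} :=
    isClosed_eq ((hev K.shrink).comp hS) ((hev K).const_mul _)
  have hsub : {q : contPairs K | q.1 ∈ smoothPairs K} ⊆
      {q : contPairs K | f (ev1 K.shrink (S q)) = 16⁻¹ * f (ev1 K q)} := by
    intro q hq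
    change f (ev1 K.shrink (S q)) = 16⁻¹ * f (ev1 K q)
    rw [hf K q.1 hq (ev1 K q) rfl,
      hf K.shrink _ (conj_dilation_mem_smoothPairs hq) (ev1 K.shrink (S q)) rfl,
      calPath_conj_dilation hq]
  -- Smooth pairs are dense in `contPairs K`, so the closed condition `hclosed` extends from them to
  -- `p`.
  have hdense : (⟨p, hp⟩ : contPairs K) ∈ closure {q : contPairs K | q.1 ∈ smoothPairs K} := by
    rw [closure_subtype]
    refine closure_mono ?_ hp
    exact fun q hq => ⟨⟨q, subset_closure hq⟩, hq, rfl⟩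
  exact ⟨(ev1 K.shrink (S ⟨p, hp⟩)).2, closure_minimal hsub hclosed hdense⟩

/-! ### Self-similarity of the infinite twist and the contradiction -/

theorem apply_pow_of_hom {f : hameo → ℝ}
    (hmul : ∀ φ ψ χ : hameo, (χ : ℂ ≃ₜ ℂ) = (φ : ℂ ≃ₜ ℂ) * (ψ : ℂ ≃ₜ ℂ) → f χ = f φ + f ψ)
    (φ : hameo) (n : ℕ) : ∃ h : (φ : ℂ ≃ₜ ℂ) ^ n ∈ hameo, f ⟨_, h⟩ = n * f φ := by
  induction n with
  | zero =>
    refine ⟨one_mem_hameo, ?_⟩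
    have h := hmul ⟨1, one_mem_hameo⟩ ⟨1, one_mem_hameo⟩ ⟨1, one_mem_hameo⟩ (mul_one _).symm
    have h' : f ⟨1, one_mem_hameo⟩ = 0 := by linarith
    simpa using h'
  | succ n ih =>
    obtain ⟨h, hn⟩ := ih
    have h1 : (φ : ℂ ≃ₜ ℂ) ^ (n + 1) ∈ hameo := by
      rw [pow_succ]
      exact mul_mem_hameo h φ.2
    refine ⟨h1, ?_⟩
    rw [hmul ⟨_, h⟩ φ ⟨_, h1⟩ (pow_succ _ _), hn]
    push_cast
    ring

/-- The infinite twist is the product of its first piece and of a rescaled power of itself. -/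
theorem infTwist_eq_mul {ρ : ℕ → ℝ → ℝ} (h : DyadicProfile ρ) :
    infTwist h = twist (ρ 0) (h.smooth 0).continuous.continuousOn *
      (dilation⁻¹ * infTwist h ^ 16 * dilation) := by
  ext z
  change twistFun (totalProfile ρ) z =
    twistFun (ρ 0) (dilation.symm ((infTwist h ^ 16) (dilation z)))
  have h1 : (infTwist h ^ 16) (dilation z) =
      twistFun (fun r => ((16 : ℕ) : ℝ) * totalProfile ρ r) (dilation z) :=
    twist_pow_apply h.continuousOn 16 _
  have h2 : dilation.symm ((infTwist h ^ 16) (dilation z)) =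
      twistFun (fun r => 2 ^ 4 * totalProfile ρ (2 * r)) z := by
    rw [h1, dilation_symm_apply, dilation_apply, twistFun, twistFun, norm_smul, smul_mul_assoc,
      inv_smul_smul₀ two_ne_zero]
    norm_num
  rw [h2]
  by_cases hz : z = 0
  · simp [hz, twistFun]
  · rw [twistFun, twistFun, norm_twistFun, twistFun, mul_assoc, ← Complex.exp_add,
      h.totalProfile_self_similar (norm_pos_iff.2 hz)]
    push_cast
    ring_nf

/-- If the Calabi homomorphism extends, then the infinite twist is not in `Hameo(D², ∂D²)`. -/
theorem infTwist_notMem_hameo (hF : CalabiExtends) {ρ : ℕ → ℝ → ℝ} (h : DyadicProfile ρ) :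
    infTwist h ∉ hameo := by
  intro hφ
  obtain ⟨f, hmul, hf, hc⟩ := hF
  obtain ⟨b, hb, hout⟩ := h.exists_outer
  have hP := h.twistProfile_zero hb hout
  have hτ : twist (ρ 0) (h.smooth 0).continuous.continuousOn ∈ hameo :=
    ⟨_, hP.pair, subset_closure hP.pair_mem, hP.pair_path_one⟩
  have hτ1 : f ⟨_, hτ⟩ = 1 := by
    rw [hf _ _ hP.pair_mem _ hP.pair_path_one.symm, calPath]
    simp [TwistProfile.pair, h.calabi]
  obtain ⟨hpow, hfpow⟩ := apply_pow_of_hom hmul ⟨_, hφ⟩ 16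
  obtain ⟨hχ, hfχ⟩ := calabi_conj_dilation hf hc hpow
  -- After substitution this reads f(φ) = 1 + 16⁻¹ · (16 f(φ)).
  have key := hmul ⟨_, hτ⟩ ⟨_, hχ⟩ ⟨_, hφ⟩ (infTwist_eq_mul h)
  rw [hτ1, hfχ, hfpow] at key
  push_cast at key
  linarith

end DiscHam

theorem theorem7p5 (hFathi : DiscHam.CalabiExtends) :
    (∀ (ρ : ℕ → ℝ → ℝ) (hρ : DiscHam.DyadicProfile ρ),
      DiscHam.infTwist hρ ∈ DiscHam.sympeo ∧ DiscHam.infTwist hρ ∉ DiscHam.hameo) ∧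
    ∃ S N : Subgroup (ℂ ≃ₜ ℂ), (S : Set (ℂ ≃ₜ ℂ)) = DiscHam.sympeo ∧
      (N : Set (ℂ ≃ₜ ℂ)) = DiscHam.hameo ∧ N < S ∧ (N.subgroupOf S).Normal := by
  have hmem : ∀ (ρ : ℕ → ℝ → ℝ) (hρ : DiscHam.DyadicProfile ρ),
      DiscHam.infTwist hρ ∈ DiscHam.sympeo ∧ DiscHam.infTwist hρ ∉ DiscHam.hameo :=
    fun _ hρ => ⟨hρ.infTwist_mem_sympeo, DiscHam.infTwist_notMem_hameo hFathi hρ⟩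
  -- Strictness of the inclusion needs an actual infinite twist as witness.
  obtain ⟨ρ, hρ⟩ := DiscHam.exists_dyadicProfile
  refine ⟨hmem, DiscHam.sympeoGroup, DiscHam.hameoGroup, rfl, rfl, ?_, DiscHam.hameoGroup_normal⟩
  exact SetLike.lt_iff_le_and_exists.2 ⟨DiscHam.hameo_subset_sympeo, _, hmem ρ hρ⟩
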